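/- All $3$-categories are small and strict; $\ast_i$ denotes $i$-composition ($y \ast_i x$ is "$y$ after $x$"), $1_x$ the identity of $x$, $\ast_0$ binds tighter than $\ast_1$ and $\ast_1$ tighter than $\ast_2$, lower cells in a composite stand for their iterated identities, and $gf := g \ast_0 f$ for $1$-cells. A $1$-category is regarded as a $3$-category all of whose $2$- and $3$-cells are identities. **Definition.** Let $A$, $B$ be $3$-categories. A *normalised oplax $3$-functor* $F \colon A \to B$ consists of the following data: an object $F(a)$ for each object $a$; a $1$-cell $F(f) \colon F(a) \to F(a')$ for each $1$-cell $f \colon a \to a'$; a $2$-cell $F(\alpha) \colon F(f) \to F(f')$ for each $2$-cell $\alpha \colon f \to f'$; a $3$-cell $F(\Gamma) \colon F(\alpha) \to F(\alpha')$ for each $3$-cell $\Gamma \colon \alpha \to \alpha'$; for composable $1$-cells $f, g, h$ (in this order), a $2$-cell $F(g,f) \colon F(gf) \to F(g) \ast_0 F(f)$ and a $3$-cell $$F(h,g,f) \colon F(h) \ast_0 F(g,f) \ast_1 F(h, gf) \to F(h,g) \ast_0 F(f) \ast_1 F(hg, f);$$ for $\alpha \colon f \to f' \colon a \to a'$ and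 $g \colon a' \to a''$, a $3$-cell $$F(g, \alpha) \colon F(g) \ast_0 F(\alpha) \ast_1 F(g,f) \to F(g,f') \ast_1 F(g \ast_0 \alpha);$$ for $f \colon a \to a'$ and $\beta \colon g \to g' \colon a' \to a''$, a $3$-cell $$F(\beta, f) \colon F(g',f) \ast_1 F(\beta \ast_0 f) \to F(\beta) \ast_0 F(f) \ast_1 F(g,f).$$ *Normalisation.* $F(1_x) = 1_{F(x)}$ for every object, $1$-cell or $2$-cell $x$; $F(1_{a'}, f) = F(f, 1_a) = 1_{F(f)}$; $F(g,f,1_a) = F(g,1_{a'},f) = F(1_{a''},g,f) = 1_{F(g,f)}$; $F(g, 1_f) = 1_{F(g,f)}$ and $F(1_{a'}, \alpha) = 1_{F(\alpha)}$; $F(1_g, f) = 1_{F(g,f)}$ and $F(\beta, 1_{a'}) = 1_{F(\beta)}$. *Coherences*, for all cells of $A$ for which the expressions make sense: 1. $F(\beta) \ast_1 F(\alpha) = F(\beta \ast_1 \alpha)$ for $1$-composable $2$-cells (the induced equality of identity $3$-cells for three $1$-composable $2$-cells is then automatic). 2. For composable $1$-cells $f,g,h,i$, the $3$-cell $$\bigl(F(i,h)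 \ast_0 F(g) \ast_0 F(f) \ast_1 F(ih,g,f)\bigr) \ast_2 \bigl(F(i) \ast_0 F(h) \ast_0 F(g,f) \ast_1 F(i,h,gf)\bigr)$$ equals $$\bigl(F(i,h,g) \ast_0 F(f) \ast_1 F(ihg,f)\bigr) \ast_2 \bigl(F(i) \ast_0 F(h,g) \ast_0 F(f) \ast_1 F(i,hg,f)\bigr) \ast_2 \bigl(F(i) \ast_0 F(h,g,f) \ast_1 F(i,hgf)\bigr).$$ 3. For $1$-cells $f, g$ followed by a $2$-cell $\alpha \colon h \to h'$, the $3$-cell $$\bigl(F(\alpha) \ast_0 F(g) \ast_0 F(f) \ast_1 F(h,g,f)\bigr) \ast_2 \bigl(F(h') \ast_0 F(g,f) \ast_1 F(\alpha,gf)\bigr)$$ equals $$\bigl(F(\alpha,g) \ast_0 F(f) \ast_1 F(hg,f)\bigr) \ast_2 \bigl(F(h',g) \ast_0 F(f) \ast_1 F(\alpha \ast_0 g,f)\bigr) \ast_2 \bigl(F(h',g,f) \ast_1 F(\alpha \ast_0 g \ast_0 f)\bigr).$$ 4. For a $1$-cell $f$, then a $2$-cell $\alpha \colon g \to g'$, then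 a $1$-cell $h$, the $3$-cell $$\bigl(F(h,g') \ast_0 F(f) \ast_1 F(h \ast_0 \alpha,f)\bigr) \ast_2 \bigl(F(h,g',f) \ast_1 F(h \ast_0 \alpha \ast_0 f)\bigr) \ast_2 \bigl(F(h) \ast_0 F(g',f) \ast_1 F(h,\alpha \ast_0 f)\bigr)$$ equals $$\bigl(F(h,\alpha) \ast_0 F(f) \ast_1 F(hg,f)\bigr) \ast_2 \bigl(F(h) \ast_0 F(\alpha) \ast_0 F(f) \ast_1 F(h,g,f)\bigr) \ast_2 \bigl(F(h) \ast_0 F(\alpha,f) \ast_1 F(h,gf)\bigr).$$ 5. For a $2$-cell $\alpha \colon f \to f'$ followed by $1$-cells $g$, $h$, the $3$-cell $$\bigl(F(h,g) \ast_0 F(f') \ast_1 F(hg,\alpha)\bigr) \ast_2 \bigl(F(h) \ast_0 F(g) \ast_0 F(\alpha) \ast_1 F(h,g,f)\bigr)$$ equals $$\bigl(F(h,g,f') \ast_1 F(h \ast_0 g \ast_0 \alpha)\bigr) \ast_2 \bigl(F(h) \ast_0 F(g,f') \ast_1 F(h,g \ast_0 \alpha)\bigr) \ast_2 \bigl(F(h)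 \ast_0 F(g,\alpha) \ast_1 F(h,gf)\bigr).$$ 6. For $1$-composable $\alpha, \beta$: $F(g,\beta \ast_1 \alpha) = \bigl(F(g,\beta) \ast_1 F(g \ast_0 \alpha)\bigr) \ast_2 \bigl(F(g) \ast_0 F(\beta) \ast_1 F(g,\alpha)\bigr)$ and $F(\beta \ast_1 \alpha,f) = \bigl(F(\beta) \ast_0 F(f) \ast_1 F(\alpha,f)\bigr) \ast_2 \bigl(F(\beta,f) \ast_1 F(\alpha \ast_0 f)\bigr)$. 7. For $\alpha \colon f \to f'$ and $\beta \colon g \to g'$ that are $0$-composable, the $3$-cell $$\bigl(F(\beta) \ast_0 F(f') \ast_1 F(g,\alpha)\bigr) \ast_2 \bigl(F(g') \ast_0 F(\alpha) \ast_1 F(\beta,f)\bigr)$$ equals $$\bigl(F(\beta,f') \ast_1 F(g \ast_0 \alpha)\bigr) \ast_2 \bigl(F(g',\alpha) \ast_1 F(\beta \ast_0 f)\bigr).$$ 8. $F(\Delta \ast_2 \Gamma) = F(\Delta) \ast_2 F(\Gamma)$, $F(\Gamma \ast_1 \alpha) = F(\Gamma) \ast_1 F(\alpha)$ and $F(\beta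 \ast_1 \Gamma) = F(\beta) \ast_1 F(\Gamma)$ for $2$-cells $\alpha,\beta$ and $3$-cells $\Gamma,\Delta$. 9. For a $1$-cell $f$ followed by a $3$-cell $\Gamma \colon \beta \to \beta'$ between $2$-cells $g \to g'$: $F(\beta',f) \ast_2 \bigl(F(g',f) \ast_1 F(\Gamma \ast_0 f)\bigr) = \bigl(F(\Gamma) \ast_0 F(f) \ast_1 F(g,f)\bigr) \ast_2 F(\beta,f)$. 10. For a $3$-cell $\Gamma \colon \alpha \to \alpha'$ between $2$-cells $f \to f'$, followed by a $1$-cell $g$: $\bigl(F(g,f') \ast_1 F(g \ast_0 \Gamma)\bigr) \ast_2 F(g,\alpha) = F(g,\alpha') \ast_2 \bigl(F(g) \ast_0 F(\Gamma) \ast_1 F(g,f)\bigr)$. **Proposition.** Let $A$ be a $1$-category, let $B$ and $C$ be $3$-categories, and let $F \colon A \to B$ and $G \colon B \to C$ be normalised oplax $3$-functors. Define, for an object $a$ and composable $1$-cells $f, g, h$ of $A$, $$GF(a) = G(F(a)), \qquad GF(f) = G(F(f)), \qquad GF(g,f) = G\bigl(F(g),F(f)\bigr) \ast_1 G\bigl(F(g,f)\bigr),$$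 and let $GF(h,g,f)$ be the $3$-cell $$\begin{aligned} &\bigl(G(F(h),F(g)) \ast_0 GF(f) \ast_1 G(F(h,g),F(f)) \ast_1 G(F(hg,f))\bigr)\\ \ast_2\ &\bigl(G(F(h),F(g),F(f)) \ast_1 G(F(h,g,f))\bigr)\\ \ast_2\ &\bigl(GF(h) \ast_0 G(F(g),F(f)) \ast_1 G(F(h),F(g,f)) \ast_1 G(F(h,gf))\bigr). \end{aligned}$$ Then these data define a normalised oplax $3$-functor $GF \colon A \to C$: there is one, and only one (its values on the identity $2$- and $3$-cells of $A$ being forced by normalisation), normalised oplax $3$-functor $A \to C$ with these values on objects, $1$-cells, composable pairs and composable triples of $1$-cells. -/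

import Mathlib

universe u u₁ u₂ u₃

/-- A small strict `3`-category, presented as a category enriched in strict `2`-categories:
for objects `a` and `b`, the `1`-, `2`- and `3`-cells with `0`-source `a` and `0`-target `b` form
the strict `2`-category of maps from `a` to `b`, and `0`-composition is `2`-functorial.

The operation `compⱼᵢ` is the `i`-composition of `j`-cells; `compⱼᵢ y x` is "`y` after `x`".
The `0`-compositions are defined on composable cells by typing. The operations `comp₂₁`, `comp₃₁`
and `comp₃₂` are only meaningful on pairs `y`, `x` such that the target of `x` (of the relevant
dimension) is the source of `y`: their values on other pairs are irrelevant, and no axiom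
constrains them. -/
structure ThreeCat where
  /-- objects -/
  Obj : Type u
  /-- `1`-cells -/
  Hom : Obj → Obj → Type u
  /-- `2`-cells with given `0`-source and `0`-target -/
  Cell₂ : Obj → Obj → Type u
  /-- `3`-cells with given `0`-source and `0`-target -/
  Cell₃ : Obj → Obj → Type u
  /-- source of a `2`-cell -/
  src₁ {a b : Obj} : Cell₂ a b → Hom a b
  /-- target of a `2`-cell -/
  tgt₁ {a b : Obj} : Cell₂ a b → Hom a b
  /-- source of a `3`-cell -/
  src₂ {a b : Obj} : Cell₃ a b → Cell₂ a b
  /-- target of a `3`-cell -/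
  tgt₂ {a b : Obj} : Cell₃ a b → Cell₂ a b
  /-- identity `1`-cells -/
  id₁ (a : Obj) : Hom a a
  /-- identity `2`-cells -/
  id₂ {a b : Obj} : Hom a b → Cell₂ a b
  /-- identity `3`-cells -/
  id₃ {a b : Obj} : Cell₂ a b → Cell₃ a b
  /-- `0`-composition of `1`-cells -/
  comp₁₀ {a b c : Obj} : Hom b c → Hom a b → Hom a c
  /-- `0`-composition of `2`-cells -/
  comp₂₀ {a b c : Obj} : Cell₂ b c → Cell₂ a b → Cell₂ a c
  /-- `0`-composition of `3`-cells -/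
  comp₃₀ {a b c : Obj} : Cell₃ b c → Cell₃ a b → Cell₃ a c
  /-- `1`-composition of `2`-cells -/
  comp₂₁ {a b : Obj} : Cell₂ a b → Cell₂ a b → Cell₂ a b
  /-- `1`-composition of `3`-cells -/
  comp₃₁ {a b : Obj} : Cell₃ a b → Cell₃ a b → Cell₃ a b
  /-- `2`-composition of `3`-cells -/
  comp₃₂ {a b : Obj} : Cell₃ a b → Cell₃ a b → Cell₃ a b
  -- globularity
  src₁_src₂ {a b : Obj} (Γ : Cell₃ a b) : src₁ (src₂ Γ) = src₁ (tgt₂ Γ)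
  tgt₁_src₂ {a b : Obj} (Γ : Cell₃ a b) : tgt₁ (src₂ Γ) = tgt₁ (tgt₂ Γ)
  -- sources and targets of identities
  src₁_id₂ {a b : Obj} (f : Hom a b) : src₁ (id₂ f) = f
  tgt₁_id₂ {a b : Obj} (f : Hom a b) : tgt₁ (id₂ f) = f
  src₂_id₃ {a b : Obj} (α : Cell₂ a b) : src₂ (id₃ α) = α
  tgt₂_id₃ {a b : Obj} (α : Cell₂ a b) : tgt₂ (id₃ α) = α
  -- sources and targets of composites
  src₁_comp₂₀ {a b c : Obj} (β : Cell₂ b c) (α : Cell₂ a b) :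
    src₁ (comp₂₀ β α) = comp₁₀ (src₁ β) (src₁ α)
  tgt₁_comp₂₀ {a b c : Obj} (β : Cell₂ b c) (α : Cell₂ a b) :
    tgt₁ (comp₂₀ β α) = comp₁₀ (tgt₁ β) (tgt₁ α)
  src₂_comp₃₀ {a b c : Obj} (Δ : Cell₃ b c) (Γ : Cell₃ a b) :
    src₂ (comp₃₀ Δ Γ) = comp₂₀ (src₂ Δ) (src₂ Γ)
  tgt₂_comp₃₀ {a b c : Obj} (Δ : Cell₃ b c) (Γ : Cell₃ a b) :
    tgt₂ (comp₃₀ Δ Γ) = comp₂₀ (tgt₂ Δ) (tgt₂ Γ)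
  src₁_comp₂₁ {a b : Obj} (β α : Cell₂ a b) (h : tgt₁ α = src₁ β) :
    src₁ (comp₂₁ β α) = src₁ α
  tgt₁_comp₂₁ {a b : Obj} (β α : Cell₂ a b) (h : tgt₁ α = src₁ β) :
    tgt₁ (comp₂₁ β α) = tgt₁ β
  src₂_comp₃₁ {a b : Obj} (Δ Γ : Cell₃ a b) (h : tgt₁ (src₂ Γ) = src₁ (src₂ Δ)) :
    src₂ (comp₃₁ Δ Γ) = comp₂₁ (src₂ Δ) (src₂ Γ)
  tgt₂_comp₃₁ {a b : Obj} (Δ Γ : Cell₃ a b) (h : tgt₁ (src₂ Γ) = src₁ (src₂ Δ)) :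
    tgt₂ (comp₃₁ Δ Γ) = comp₂₁ (tgt₂ Δ) (tgt₂ Γ)
  src₂_comp₃₂ {a b : Obj} (Δ Γ : Cell₃ a b) (h : tgt₂ Γ = src₂ Δ) :
    src₂ (comp₃₂ Δ Γ) = src₂ Γ
  tgt₂_comp₃₂ {a b : Obj} (Δ Γ : Cell₃ a b) (h : tgt₂ Γ = src₂ Δ) :
    tgt₂ (comp₃₂ Δ Γ) = tgt₂ Δ
  -- unit laws
  id_comp₁₀ {a b : Obj} (f : Hom a b) : comp₁₀ (id₁ b) f = f
  comp₁₀_id {a b : Obj} (f : Hom a b) : comp₁₀ f (id₁ a) = f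
  id_comp₂₀ {a b : Obj} (α : Cell₂ a b) : comp₂₀ (id₂ (id₁ b)) α = α
  comp₂₀_id {a b : Obj} (α : Cell₂ a b) : comp₂₀ α (id₂ (id₁ a)) = α
  id_comp₃₀ {a b : Obj} (Γ : Cell₃ a b) : comp₃₀ (id₃ (id₂ (id₁ b))) Γ = Γ
  comp₃₀_id {a b : Obj} (Γ : Cell₃ a b) : comp₃₀ Γ (id₃ (id₂ (id₁ a))) = Γ
  id_comp₂₁ {a b : Obj} (α : Cell₂ a b) : comp₂₁ (id₂ (tgt₁ α)) α = α
  comp₂₁_id {a b : Obj} (α : Cell₂ a b) : comp₂₁ α (id₂ (src₁ α)) = α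
  id_comp₃₁ {a b : Obj} (Γ : Cell₃ a b) : comp₃₁ (id₃ (id₂ (tgt₁ (src₂ Γ)))) Γ = Γ
  comp₃₁_id {a b : Obj} (Γ : Cell₃ a b) : comp₃₁ Γ (id₃ (id₂ (src₁ (src₂ Γ)))) = Γ
  id_comp₃₂ {a b : Obj} (Γ : Cell₃ a b) : comp₃₂ (id₃ (tgt₂ Γ)) Γ = Γ
  comp₃₂_id {a b : Obj} (Γ : Cell₃ a b) : comp₃₂ Γ (id₃ (src₂ Γ)) = Γ
  -- composites of identities
  id₂_comp₁₀ {a b c : Obj} (g : Hom b c) (f : Hom a b) :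
    id₂ (comp₁₀ g f) = comp₂₀ (id₂ g) (id₂ f)
  id₃_comp₂₀ {a b c : Obj} (β : Cell₂ b c) (α : Cell₂ a b) :
    id₃ (comp₂₀ β α) = comp₃₀ (id₃ β) (id₃ α)
  id₃_comp₂₁ {a b : Obj} (β α : Cell₂ a b) (h : tgt₁ α = src₁ β) :
    id₃ (comp₂₁ β α) = comp₃₁ (id₃ β) (id₃ α)
  -- associativity
  assoc₁₀ {a b c d : Obj} (h : Hom c d) (g : Hom b c) (f : Hom a b) :
    comp₁₀ (comp₁₀ h g) f = comp₁₀ h (comp₁₀ g f)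
  assoc₂₀ {a b c d : Obj} (γ : Cell₂ c d) (β : Cell₂ b c) (α : Cell₂ a b) :
    comp₂₀ (comp₂₀ γ β) α = comp₂₀ γ (comp₂₀ β α)
  assoc₃₀ {a b c d : Obj} (Θ : Cell₃ c d) (Δ : Cell₃ b c) (Γ : Cell₃ a b) :
    comp₃₀ (comp₃₀ Θ Δ) Γ = comp₃₀ Θ (comp₃₀ Δ Γ)
  assoc₂₁ {a b : Obj} (γ β α : Cell₂ a b) (h : tgt₁ α = src₁ β) (h' : tgt₁ β = src₁ γ) :
    comp₂₁ (comp₂₁ γ β) α = comp₂₁ γ (comp₂₁ β α)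
  assoc₃₁ {a b : Obj} (Θ Δ Γ : Cell₃ a b) (h : tgt₁ (src₂ Γ) = src₁ (src₂ Δ))
    (h' : tgt₁ (src₂ Δ) = src₁ (src₂ Θ)) :
    comp₃₁ (comp₃₁ Θ Δ) Γ = comp₃₁ Θ (comp₃₁ Δ Γ)
  assoc₃₂ {a b : Obj} (Θ Δ Γ : Cell₃ a b) (h : tgt₂ Γ = src₂ Δ) (h' : tgt₂ Δ = src₂ Θ) :
    comp₃₂ (comp₃₂ Θ Δ) Γ = comp₃₂ Θ (comp₃₂ Δ Γ)
  -- interchange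
  interchange₂ {a b c : Obj} (β' β : Cell₂ b c) (α' α : Cell₂ a b)
    (hβ : tgt₁ β = src₁ β') (hα : tgt₁ α = src₁ α') :
    comp₂₀ (comp₂₁ β' β) (comp₂₁ α' α) = comp₂₁ (comp₂₀ β' α') (comp₂₀ β α)
  interchange₃₀₁ {a b c : Obj} (Δ' Δ : Cell₃ b c) (Γ' Γ : Cell₃ a b)
    (hΔ : tgt₁ (src₂ Δ) = src₁ (src₂ Δ')) (hΓ : tgt₁ (src₂ Γ) = src₁ (src₂ Γ')) :
    comp₃₀ (comp₃₁ Δ' Δ) (comp₃₁ Γ' Γ) = comp₃₁ (comp₃₀ Δ' Γ') (comp₃₀ Δ Γ)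
  interchange₃₀₂ {a b c : Obj} (Δ' Δ : Cell₃ b c) (Γ' Γ : Cell₃ a b)
    (hΔ : tgt₂ Δ = src₂ Δ') (hΓ : tgt₂ Γ = src₂ Γ') :
    comp₃₀ (comp₃₂ Δ' Δ) (comp₃₂ Γ' Γ) = comp₃₂ (comp₃₀ Δ' Γ') (comp₃₀ Δ Γ)
  interchange₃₁₂ {a b : Obj} (Δ' Δ Γ' Γ : Cell₃ a b)
    (hΔ : tgt₂ Δ = src₂ Δ') (hΓ : tgt₂ Γ = src₂ Γ') (h : tgt₁ (src₂ Γ) = src₁ (src₂ Δ)) :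
    comp₃₁ (comp₃₂ Δ' Δ) (comp₃₂ Γ' Γ) = comp₃₂ (comp₃₁ Δ' Γ') (comp₃₁ Δ Γ)

-- As in the usual convention, `0`-composition binds tighter than `1`-composition, which binds
-- tighter than `2`-composition. Whiskerings are written with explicit identity cells.
infixr:80 " ∘₁₀ " => ThreeCat.comp₁₀ _
infixr:80 " ∘₂₀ " => ThreeCat.comp₂₀ _
infixr:80 " ∘₃₀ " => ThreeCat.comp₃₀ _
infixr:75 " ∘₂₁ " => ThreeCat.comp₂₁ _
infixr:75 " ∘₃₁ " => ThreeCat.comp₃₁ _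
infixr:70 " ∘₃₂ " => ThreeCat.comp₃₂ _

/-- A `3`-category is a `1`-category if all its `2`-cells and all its `3`-cells are identities. -/
structure ThreeCat.IsOneCategory (A : ThreeCat.{u}) : Prop where
  cell₂_eq {a b : A.Obj} (α : A.Cell₂ a b) : ∃ f : A.Hom a b, α = A.id₂ f
  cell₃_eq {a b : A.Obj} (Γ : A.Cell₃ a b) : ∃ α : A.Cell₂ a b, Γ = A.id₃ α

/-- The part of the data of an oplax `3`-functor that involves only objects and `1`-cells of the
source. -/
structure OplaxData₁ (A : ThreeCat.{u₁}) (B : ThreeCat.{u₂}) where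
  /-- the image of an object -/
  obj : A.Obj → B.Obj
  /-- the image of a `1`-cell -/
  map {a b : A.Obj} : A.Hom a b → B.Hom (obj a) (obj b)
  /-- the `2`-cell attached to two composable `1`-cells -/
  V {a b c : A.Obj} (g : A.Hom b c) (f : A.Hom a b) : B.Cell₂ (obj a) (obj c)
  /-- the `3`-cell attached to three composable `1`-cells -/
  W {a b c d : A.Obj} (h : A.Hom c d) (g : A.Hom b c) (f : A.Hom a b) :
    B.Cell₃ (obj a) (obj d)

/-- The data of an oplax `3`-functor. -/
structure OplaxData (A : ThreeCat.{u₁}) (B : ThreeCat.{u₂}) extends OplaxData₁ A B where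
  /-- the image of a `2`-cell -/
  map₂ {a b : A.Obj} : A.Cell₂ a b → B.Cell₂ (obj a) (obj b)
  /-- the `3`-cell attached to a `2`-cell `α` followed by a `1`-cell `g` -/
  VR {a b c : A.Obj} (g : A.Hom b c) (α : A.Cell₂ a b) : B.Cell₃ (obj a) (obj c)
  /-- the `3`-cell attached to a `1`-cell `f` followed by a `2`-cell `β` -/
  VL {a b c : A.Obj} (β : A.Cell₂ b c) (f : A.Hom a b) : B.Cell₃ (obj a) (obj c)
  /-- the image of a `3`-cell -/
  map₃ {a b : A.Obj} : A.Cell₃ a b → B.Cell₃ (obj a) (obj b)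

/-- Data as above form a normalised oplax `3`-functor: the structural cells have the prescribed
sources and targets, and the normalisation and coherence conditions hold. -/
structure OplaxData.IsNormalisedOplax {A : ThreeCat.{u₁}} {B : ThreeCat.{u₂}}
    (F : OplaxData A B) : Prop where
  -- sources and targets
  src_V {a b c : A.Obj} (g : A.Hom b c) (f : A.Hom a b) :
    B.src₁ (F.V g f) = F.map (g ∘₁₀ f)
  tgt_V {a b c : A.Obj} (g : A.Hom b c) (f : A.Hom a b) :
    B.tgt₁ (F.V g f) = F.map g ∘₁₀ F.map f
  src_map₂ {a b : A.Obj} (α : A.Cell₂ a b) : B.src₁ (F.map₂ α) = F.map (A.src₁ α)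
  tgt_map₂ {a b : A.Obj} (α : A.Cell₂ a b) : B.tgt₁ (F.map₂ α) = F.map (A.tgt₁ α)
  src_W {a b c d : A.Obj} (h : A.Hom c d) (g : A.Hom b c) (f : A.Hom a b) :
    B.src₂ (F.W h g f) = B.id₂ (F.map h) ∘₂₀ F.V g f ∘₂₁ F.V h (g ∘₁₀ f)
  tgt_W {a b c d : A.Obj} (h : A.Hom c d) (g : A.Hom b c) (f : A.Hom a b) :
    B.tgt₂ (F.W h g f) = F.V h g ∘₂₀ B.id₂ (F.map f) ∘₂₁ F.V (h ∘₁₀ g) f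
  src_VR {a b c : A.Obj} (g : A.Hom b c) (α : A.Cell₂ a b) :
    B.src₂ (F.VR g α) = B.id₂ (F.map g) ∘₂₀ F.map₂ α ∘₂₁ F.V g (A.src₁ α)
  tgt_VR {a b c : A.Obj} (g : A.Hom b c) (α : A.Cell₂ a b) :
    B.tgt₂ (F.VR g α) = F.V g (A.tgt₁ α) ∘₂₁ F.map₂ (A.id₂ g ∘₂₀ α)
  src_VL {a b c : A.Obj} (β : A.Cell₂ b c) (f : A.Hom a b) :
    B.src₂ (F.VL β f) = F.V (A.tgt₁ β) f ∘₂₁ F.map₂ (β ∘₂₀ A.id₂ f)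
  tgt_VL {a b c : A.Obj} (β : A.Cell₂ b c) (f : A.Hom a b) :
    B.tgt₂ (F.VL β f) = F.map₂ β ∘₂₀ B.id₂ (F.map f) ∘₂₁ F.V (A.src₁ β) f
  src_map₃ {a b : A.Obj} (Γ : A.Cell₃ a b) : B.src₂ (F.map₃ Γ) = F.map₂ (A.src₂ Γ)
  tgt_map₃ {a b : A.Obj} (Γ : A.Cell₃ a b) : B.tgt₂ (F.map₃ Γ) = F.map₂ (A.tgt₂ Γ)
  -- normalisation
  map_id (a : A.Obj) : F.map (A.id₁ a) = B.id₁ (F.obj a)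
  map₂_id {a b : A.Obj} (f : A.Hom a b) : F.map₂ (A.id₂ f) = B.id₂ (F.map f)
  V_id_left {a b : A.Obj} (f : A.Hom a b) : F.V (A.id₁ b) f = B.id₂ (F.map f)
  V_id_right {a b : A.Obj} (f : A.Hom a b) : F.V f (A.id₁ a) = B.id₂ (F.map f)
  map₃_id {a b : A.Obj} (α : A.Cell₂ a b) : F.map₃ (A.id₃ α) = B.id₃ (F.map₂ α)
  W_id_right {a b c : A.Obj} (g : A.Hom b c) (f : A.Hom a b) :
    F.W g f (A.id₁ a) = B.id₃ (F.V g f)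
  W_id_middle {a b c : A.Obj} (g : A.Hom b c) (f : A.Hom a b) :
    F.W g (A.id₁ b) f = B.id₃ (F.V g f)
  W_id_left {a b c : A.Obj} (g : A.Hom b c) (f : A.Hom a b) :
    F.W (A.id₁ c) g f = B.id₃ (F.V g f)
  VR_id₂ {a b c : A.Obj} (g : A.Hom b c) (f : A.Hom a b) :
    F.VR g (A.id₂ f) = B.id₃ (F.V g f)
  VR_id₁ {a b : A.Obj} (α : A.Cell₂ a b) : F.VR (A.id₁ b) α = B.id₃ (F.map₂ α)
  VL_id₂ {a b c : A.Obj} (g : A.Hom b c) (f : A.Hom a b) :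
    F.VL (A.id₂ g) f = B.id₃ (F.V g f)
  VL_id₁ {a b : A.Obj} (β : A.Cell₂ a b) : F.VL β (A.id₁ a) = B.id₃ (F.map₂ β)
  -- vertical composition of two `2`-cells
  coh_Y {a b : A.Obj} (β α : A.Cell₂ a b) (h : A.tgt₁ α = A.src₁ β) :
    F.map₂ β ∘₂₁ F.map₂ α = F.map₂ (β ∘₂₁ α)
  -- four composable `1`-cells
  coh_1111 {a b c d e : A.Obj}
      (i : A.Hom d e) (h : A.Hom c d) (g : A.Hom b c) (f : A.Hom a b) :
    (B.id₃ (F.V i h ∘₂₀ B.id₂ (F.map g) ∘₂₀ B.id₂ (F.map f)) ∘₃₁ F.W (i ∘₁₀ h) g f)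
      ∘₃₂ (B.id₃ (B.id₂ (F.map i) ∘₂₀ B.id₂ (F.map h) ∘₂₀ F.V g f) ∘₃₁ F.W i h (g ∘₁₀ f))
    = (F.W i h g ∘₃₀ B.id₃ (B.id₂ (F.map f)) ∘₃₁ B.id₃ (F.V (i ∘₁₀ h ∘₁₀ g) f))
      ∘₃₂ (B.id₃ (B.id₂ (F.map i) ∘₂₀ F.V h g ∘₂₀ B.id₂ (F.map f)) ∘₃₁ F.W i (h ∘₁₀ g) f)
      ∘₃₂ (B.id₃ (B.id₂ (F.map i)) ∘₃₀ F.W h g f ∘₃₁ B.id₃ (F.V i (h ∘₁₀ g ∘₁₀ f)))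
  -- two `1`-cells followed by a `2`-cell
  coh_211 {a b c d : A.Obj} (α : A.Cell₂ c d) (g : A.Hom b c) (f : A.Hom a b) :
    (B.id₃ (F.map₂ α ∘₂₀ B.id₂ (F.map g) ∘₂₀ B.id₂ (F.map f)) ∘₃₁ F.W (A.src₁ α) g f)
      ∘₃₂ (B.id₃ (B.id₂ (F.map (A.tgt₁ α)) ∘₂₀ F.V g f) ∘₃₁ F.VL α (g ∘₁₀ f))
    = (F.VL α g ∘₃₀ B.id₃ (B.id₂ (F.map f)) ∘₃₁ B.id₃ (F.V (A.src₁ α ∘₁₀ g) f))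
      ∘₃₂ (B.id₃ (F.V (A.tgt₁ α) g ∘₂₀ B.id₂ (F.map f)) ∘₃₁ F.VL (α ∘₂₀ A.id₂ g) f)
      ∘₃₂ (F.W (A.tgt₁ α) g f ∘₃₁ B.id₃ (F.map₂ (α ∘₂₀ A.id₂ g ∘₂₀ A.id₂ f)))
  -- a `1`-cell followed by a `2`-cell followed by a `1`-cell
  coh_121 {a b c d : A.Obj} (h : A.Hom c d) (α : A.Cell₂ b c) (f : A.Hom a b) :
    (B.id₃ (F.V h (A.tgt₁ α) ∘₂₀ B.id₂ (F.map f)) ∘₃₁ F.VL (A.id₂ h ∘₂₀ α) f)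
      ∘₃₂ (F.W h (A.tgt₁ α) f ∘₃₁ B.id₃ (F.map₂ (A.id₂ h ∘₂₀ α ∘₂₀ A.id₂ f)))
      ∘₃₂ (B.id₃ (B.id₂ (F.map h) ∘₂₀ F.V (A.tgt₁ α) f) ∘₃₁ F.VR h (α ∘₂₀ A.id₂ f))
    = (F.VR h α ∘₃₀ B.id₃ (B.id₂ (F.map f)) ∘₃₁ B.id₃ (F.V (h ∘₁₀ A.src₁ α) f))
      ∘₃₂ (B.id₃ (B.id₂ (F.map h) ∘₂₀ F.map₂ α ∘₂₀ B.id₂ (F.map f)) ∘₃₁ F.W h (A.src₁ α) f)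
      ∘₃₂ (B.id₃ (B.id₂ (F.map h)) ∘₃₀ F.VL α f ∘₃₁ B.id₃ (F.V h (A.src₁ α ∘₁₀ f)))
  -- a `2`-cell followed by two `1`-cells
  coh_112 {a b c d : A.Obj} (h : A.Hom c d) (g : A.Hom b c) (α : A.Cell₂ a b) :
    (B.id₃ (F.V h g ∘₂₀ B.id₂ (F.map (A.tgt₁ α))) ∘₃₁ F.VR (h ∘₁₀ g) α)
      ∘₃₂ (B.id₃ (B.id₂ (F.map h) ∘₂₀ B.id₂ (F.map g) ∘₂₀ F.map₂ α) ∘₃₁ F.W h g (A.src₁ α))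
    = (F.W h g (A.tgt₁ α) ∘₃₁ B.id₃ (F.map₂ (A.id₂ h ∘₂₀ A.id₂ g ∘₂₀ α)))
      ∘₃₂ (B.id₃ (B.id₂ (F.map h) ∘₂₀ F.V g (A.tgt₁ α)) ∘₃₁ F.VR h (A.id₂ g ∘₂₀ α))
      ∘₃₂ (B.id₃ (B.id₂ (F.map h)) ∘₃₀ F.VR g α ∘₃₁ B.id₃ (F.V h (g ∘₁₀ A.src₁ α)))
  -- a vertical composite of two `2`-cells followed by a `1`-cell
  coh_VR_Y {a b c : A.Obj} (g : A.Hom b c) (β α : A.Cell₂ a b) (h : A.tgt₁ α = A.src₁ β) :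
    F.VR g (β ∘₂₁ α)
    = (F.VR g β ∘₃₁ B.id₃ (F.map₂ (A.id₂ g ∘₂₀ α)))
      ∘₃₂ (B.id₃ (B.id₂ (F.map g) ∘₂₀ F.map₂ β) ∘₃₁ F.VR g α)
  -- a `1`-cell followed by a vertical composite of two `2`-cells
  coh_VL_Y {a b c : A.Obj} (β α : A.Cell₂ b c) (f : A.Hom a b) (h : A.tgt₁ α = A.src₁ β) :
    F.VL (β ∘₂₁ α) f
    = (B.id₃ (F.map₂ β ∘₂₀ B.id₂ (F.map f)) ∘₃₁ F.VL α f)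
      ∘₃₂ (F.VL β f ∘₃₁ B.id₃ (F.map₂ (α ∘₂₀ A.id₂ f)))
  -- two `0`-composable `2`-cells
  coh_22 {a b c : A.Obj} (β : A.Cell₂ b c) (α : A.Cell₂ a b) :
    (B.id₃ (F.map₂ β ∘₂₀ B.id₂ (F.map (A.tgt₁ α))) ∘₃₁ F.VR (A.src₁ β) α)
      ∘₃₂ (B.id₃ (B.id₂ (F.map (A.tgt₁ β)) ∘₂₀ F.map₂ α) ∘₃₁ F.VL β (A.src₁ α))
    = (F.VL β (A.tgt₁ α) ∘₃₁ B.id₃ (F.map₂ (A.id₂ (A.src₁ β) ∘₂₀ α)))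
      ∘₃₂ (F.VR (A.tgt₁ β) α ∘₃₁ B.id₃ (F.map₂ (β ∘₂₀ A.id₂ (A.src₁ α))))
  -- three `1`-composable `2`-cells (an equality of identity `3`-cells)
  coh_YY {a b : A.Obj} (γ β α : A.Cell₂ a b)
      (h : A.tgt₁ α = A.src₁ β) (h' : A.tgt₁ β = A.src₁ γ) :
    B.id₃ (F.map₂ (γ ∘₂₁ β ∘₂₁ α)) ∘₃₂ (B.id₃ (F.map₂ γ) ∘₃₁ B.id₃ (F.map₂ (β ∘₂₁ α)))
    = B.id₃ (F.map₂ ((γ ∘₂₁ β) ∘₂₁ α)) ∘₃₂ (B.id₃ (F.map₂ (γ ∘₂₁ β)) ∘₃₁ B.id₃ (F.map₂ α))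
  -- `2`-composition of `3`-cells
  map₃_comp₃₂ {a b : A.Obj} (Δ Γ : A.Cell₃ a b) (h : A.tgt₂ Γ = A.src₂ Δ) :
    F.map₃ (Δ ∘₃₂ Γ) = F.map₃ Δ ∘₃₂ F.map₃ Γ
  -- `1`-composition of a `3`-cell with a `2`-cell, on either side
  map₃_whisker_right {a b : A.Obj} (Γ : A.Cell₃ a b) (α : A.Cell₂ a b)
      (h : A.tgt₁ α = A.src₁ (A.src₂ Γ)) :
    F.map₃ Γ ∘₃₁ B.id₃ (F.map₂ α) = F.map₃ (Γ ∘₃₁ A.id₃ α)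
  map₃_whisker_left {a b : A.Obj} (β : A.Cell₂ a b) (Γ : A.Cell₃ a b)
      (h : A.tgt₁ (A.src₂ Γ) = A.src₁ β) :
    B.id₃ (F.map₂ β) ∘₃₁ F.map₃ Γ = F.map₃ (A.id₃ β ∘₃₁ Γ)
  -- a `1`-cell followed by a `3`-cell
  coh_31 {a b c : A.Obj} (Γ : A.Cell₃ b c) (f : A.Hom a b) :
    F.VL (A.tgt₂ Γ) f
      ∘₃₂ (B.id₃ (F.V (A.tgt₁ (A.src₂ Γ)) f) ∘₃₁ F.map₃ (Γ ∘₃₀ A.id₃ (A.id₂ f)))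
    = (F.map₃ Γ ∘₃₀ B.id₃ (B.id₂ (F.map f)) ∘₃₁ B.id₃ (F.V (A.src₁ (A.src₂ Γ)) f))
      ∘₃₂ F.VL (A.src₂ Γ) f
  -- a `3`-cell followed by a `1`-cell
  coh_13 {a b c : A.Obj} (g : A.Hom b c) (Γ : A.Cell₃ a b) :
    (B.id₃ (F.V g (A.tgt₁ (A.src₂ Γ))) ∘₃₁ F.map₃ (A.id₃ (A.id₂ g) ∘₃₀ Γ))
      ∘₃₂ F.VR g (A.src₂ Γ)
    = F.VR g (A.tgt₂ Γ)
      ∘₃₂ (B.id₃ (B.id₂ (F.map g)) ∘₃₀ F.map₃ Γ ∘₃₁ B.id₃ (F.V g (A.src₁ (A.src₂ Γ))))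

/-- Normalised oplax `3`-functors. -/
structure NormalisedOplaxFunctor (A : ThreeCat.{u₁}) (B : ThreeCat.{u₂}) extends
    OplaxData A B where
  isNormalisedOplax : toOplaxData.IsNormalisedOplax

/-- The explicit data of the composite `GF` on the objects and `1`-cells of `A`. -/
def NormalisedOplaxFunctor.compData {A : ThreeCat.{u₁}} {B : ThreeCat.{u₂}} {C : ThreeCat.{u₃}}
    (G : NormalisedOplaxFunctor B C) (F : NormalisedOplaxFunctor A B) : OplaxData₁ A C where
  obj a := G.obj (F.obj a)
  map f := G.map (F.map f)
  V g f := G.V (F.map g) (F.map f) ∘₂₁ G.map₂ (F.V g f)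
  W h g f :=
    (C.id₃ (G.V (F.map h) (F.map g) ∘₂₀ C.id₂ (G.map (F.map f)))
        ∘₃₁ G.VL (F.V h g) (F.map f) ∘₃₁ C.id₃ (G.map₂ (F.V (h ∘₁₀ g) f)))
      ∘₃₂ (G.W (F.map h) (F.map g) (F.map f) ∘₃₁ G.map₃ (F.W h g f))
      ∘₃₂ (C.id₃ (C.id₂ (G.map (F.map h)) ∘₂₀ G.V (F.map g) (F.map f))
        ∘₃₁ G.VR (F.map h) (F.V g f) ∘₃₁ C.id₃ (G.map₂ (F.V h (g ∘₁₀ f))))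

/-! Since every 2- and 3-cell of the source is an identity, normalisation forces all the data
outside objects, 1-cells, pairs and triples. This gives uniqueness (`eq_of_toOplaxData₁_eq`). For
existence, extend by identities (`extendById`): the coherences that involve 2- or 3-cells of the
source become trivial, and what remains is sources and targets, normalisation, and the coherence for
four composable 1-cells `f`, `g`, `h`, `i` (`comp_coh_1111`).

That coherence is the heart of the proof. Both sides run between composites of six 2-cells, three
coming from the structure of `G` and three being images under `G` of structural 2-cells of `F`. Each
cell `GF(h,g,f)` consists of four 3-cells, `G.VR`, `G.W`, `G.map₃` of `F.W`, and `G.VL`, and each of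
these touches only two adjacent factors.

Apart from interchange of 3-cells that touch disjoint factors, the two sides differ by eight
hexagons: the coherence for four 1-cells of `G`, the image under `G` of that of `F`, and the
coherences of `G` for a 2-cell with two 1-cells (three positions), for two 2-cells, and for a 3-cell
with a 1-cell (two positions). In the last two, compatibility with 1-composition cuts the square
into a hexagon. Some edges are identities that express the interchange of a cell built from `F.V i
h` with one built from `F.V g f`.

The pasting is an abstract statement about 2- and 3-cells between two fixed objects
(`hexagons_pasting`). There, 2-cells with fixed ends form a category, composites are kept bracketed
to the right, and `ofEq` records equalities of 2-cells. `hexagons_pasting_cell` then returns to bare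
3-cells. -/

open CategoryTheory

/-! ### Typed 2-cells and 3-cells between two fixed objects -/

namespace ThreeCat

variable {C : ThreeCat.{u}} {a b : C.Obj}

/-- The `2`-cells from a given `1`-cell to another. -/
structure Hom₂ (X Y : C.Hom a b) where
  cell : C.Cell₂ a b
  src : C.src₁ cell = X := by simp
  tgt : C.tgt₁ cell = Y := by simp

/-- The `3`-cells from a given `2`-cell to another. -/
@[ext]
structure Hom₃ {X Y : C.Hom a b} (α β : Hom₂ X Y) where
  cell : C.Cell₃ a b
  src : C.src₂ cell = α.cell := by simp
  tgt : C.tgt₂ cell = β.cell := by simp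

attribute [simp] src₁_id₂ tgt₁_id₂ src₂_id₃ tgt₂_id₃ src₁_comp₂₀ tgt₁_comp₂₀ src₂_comp₃₀
  tgt₂_comp₃₀ src₁_comp₂₁ tgt₁_comp₂₁ src₂_comp₃₁ tgt₂_comp₃₁ src₂_comp₃₂ tgt₂_comp₃₂
  Hom₂.src Hom₂.tgt Hom₃.src Hom₃.tgt

instance (X Y : C.Hom a b) : Category (Hom₂ X Y) where
  Hom α β := Hom₃ α β
  id α := ⟨C.id₃ α.cell, by simp, by simp⟩
  comp Γ Δ := ⟨C.comp₃₂ Δ.cell Γ.cell, by simp, by simp⟩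
  id_comp Γ := Hom₃.ext (by simpa using C.comp₃₂_id Γ.cell)
  comp_id Γ := Hom₃.ext (by simpa using C.id_comp₃₂ Γ.cell)
  assoc Γ Δ Θ := Hom₃.ext (C.assoc₃₂ _ _ _ (by simp) (by simp)).symm

section

variable {X Y Z W : C.Hom a b}

/-- The `3`-cell underlying a morphism of `Hom₂ X Y`. -/
abbrev cell₃ {α β : Hom₂ X Y} (Γ : α ⟶ β) : C.Cell₃ a b := Hom₃.cell Γ

lemma hom₃_ext {α β : Hom₂ X Y} {Γ Δ : α ⟶ β} (h : cell₃ Γ = cell₃ Δ) : Γ = Δ := Hom₃.ext h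

@[simp] lemma src₂_cell₃ {α β : Hom₂ X Y} (Γ : α ⟶ β) : C.src₂ (Hom₃.cell Γ) = α.cell := Γ.src
@[simp] lemma tgt₂_cell₃ {α β : Hom₂ X Y} (Γ : α ⟶ β) : C.tgt₂ (Hom₃.cell Γ) = β.cell := Γ.tgt

@[simp] lemma cell₃_comp {α β γ : Hom₂ X Y} (Γ : α ⟶ β) (Δ : β ⟶ γ) :
    cell₃ (Γ ≫ Δ) = cell₃ Δ ∘₃₂ cell₃ Γ := rfl

/-- `1`-composition: `x` after `y`. -/
def hcomp (x : Hom₂ Y Z) (y : Hom₂ X Y) : Hom₂ X Z :=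
  ⟨C.comp₂₁ x.cell y.cell, by simp, by simp⟩

infixr:75 " ⊚ " => hcomp

@[simp] lemma hcomp_cell (x : Hom₂ Y Z) (y : Hom₂ X Y) :
    (x ⊚ y).cell = x.cell ∘₂₁ y.cell := rfl

/-- `1`-composition of a `3`-cell with a `2`-cell after it. -/
def wl (x : Hom₂ Y Z) {α β : Hom₂ X Y} (Γ : α ⟶ β) : x ⊚ α ⟶ x ⊚ β :=
  ⟨C.id₃ x.cell ∘₃₁ cell₃ Γ, by simp, by simp⟩

/-- `1`-composition of a `3`-cell between composites of two `2`-cells with a `2`-cell before it. -/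
def wr {V' : C.Hom a b} {x : Hom₂ Y Z} {y : Hom₂ X Y} {x' : Hom₂ V' Z} {y' : Hom₂ X V'}
    (Γ : x ⊚ y ⟶ x' ⊚ y') (r : Hom₂ W X) : x ⊚ y ⊚ r ⟶ x' ⊚ y' ⊚ r :=
  ⟨cell₃ Γ ∘₃₁ C.id₃ r.cell,
    by simp [C.assoc₂₁], by simp [C.assoc₂₁]⟩

/-- The identity `3`-cell, as a morphism between two presentations of the same `2`-cell. -/
def ofEq {α β : Hom₂ X Y} (h : α.cell = β.cell) : α ⟶ β :=
  ⟨C.id₃ α.cell, by simp, by simp [h]⟩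

@[simp] lemma cell₃_wl (x : Hom₂ Y Z) {α β : Hom₂ X Y} (Γ : α ⟶ β) :
    cell₃ (wl x Γ) = C.id₃ x.cell ∘₃₁ cell₃ Γ := rfl

@[simp] lemma cell₃_wr {V' : C.Hom a b} {x : Hom₂ Y Z} {y : Hom₂ X Y} {x' : Hom₂ V' Z}
    {y' : Hom₂ X V'} (Γ : x ⊚ y ⟶ x' ⊚ y') (r : Hom₂ W X) :
    cell₃ (wr Γ r) = cell₃ Γ ∘₃₁ C.id₃ r.cell := rfl

lemma cell₃_ofEq {α β : Hom₂ X Y} (h : α.cell = β.cell) : cell₃ (ofEq h) = C.id₃ α.cell := rfl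

-- A change of presentation leaves no trace on the underlying 3-cell. This is what allows `ofEq` to
-- be inserted for typing and discarded at the end.
@[simp] lemma cell₃_comp_ofEq {α β γ : Hom₂ X Y} (Γ : α ⟶ β) (h : β.cell = γ.cell) :
    cell₃ (Γ ≫ ofEq h) = cell₃ Γ := by
  have := C.id_comp₃₂ (cell₃ Γ)
  simpa [cell₃_ofEq] using this

lemma wl_ofEq (x : Hom₂ Y Z) {α β : Hom₂ X Y} (h : α.cell = β.cell) :
    wl x (ofEq h) = ofEq (by rw [hcomp_cell, hcomp_cell, h]) :=
  hom₃_ext (by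
    rw [cell₃_wl, cell₃_ofEq, cell₃_ofEq, hcomp_cell, C.id₃_comp₂₁ _ _ (by simp)])

lemma hcomp_cell_congr {V' : C.Hom a b} {x : Hom₂ Y Z} {y : Hom₂ X Y} {x' : Hom₂ V' Z}
    {y' : Hom₂ X V'} (h : (x ⊚ y).cell = (x' ⊚ y').cell) (r : Hom₂ W X) :
    (x ⊚ y ⊚ r).cell = (x' ⊚ y' ⊚ r).cell := by
  have := congrArg (fun t => t ∘₂₁ r.cell) h
  simpa [C.assoc₂₁] using this

lemma wr_ofEq {V' : C.Hom a b} {x : Hom₂ Y Z} {y : Hom₂ X Y} {x' : Hom₂ V' Z} {y' : Hom₂ X V'}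
    (h : (x ⊚ y).cell = (x' ⊚ y').cell) (r : Hom₂ W X) :
    wr (ofEq h) r = ofEq (hcomp_cell_congr h r) :=
  hom₃_ext (by simp [cell₃_ofEq, C.id₃_comp₂₁, C.assoc₃₁])

lemma ofEq_comp_ofEq {α β γ : Hom₂ X Y} (h : α.cell = β.cell) (h' : β.cell = γ.cell) :
    ofEq h ≫ ofEq h' = ofEq (h.trans h') := hom₃_ext (by
  rw [cell₃_comp_ofEq, cell₃_ofEq, cell₃_ofEq])

lemma wl_comp (x : Hom₂ Y Z) {α β γ : Hom₂ X Y} (Γ : α ⟶ β) (Δ : β ⟶ γ) :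
    wl x (Γ ≫ Δ) = wl x Γ ≫ wl x Δ := hom₃_ext (by
  have := C.interchange₃₁₂ (C.id₃ x.cell) (C.id₃ x.cell) (cell₃ Δ) (cell₃ Γ)
    (by simp) (by simp) (by simp)
  have h := C.id_comp₃₂ (C.id₃ x.cell)
  simp only [tgt₂_id₃] at h
  rw [h] at this
  simpa using this)

/-- Interchange, after padding each of the two 3-cells with an identity. With `exchange_left` it
shows that the two orders of performing `Γ` and `Δ` agree, both being the 1-composite. -/
lemma exchange_right {x : Hom₂ Y Z} {x' : Hom₂ Y Z} (Γ : x ⟶ x') {r r' : Hom₂ X Y} (Δ : r ⟶ r') :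
    (C.id₃ x'.cell ∘₃₁ cell₃ Δ) ∘₃₂ (cell₃ Γ ∘₃₁ C.id₃ r.cell) = cell₃ Γ ∘₃₁ cell₃ Δ := by
  rw [← C.interchange₃₁₂ _ _ _ _ (by simp) (by simp) (by simp)]
  have h₁ := C.id_comp₃₂ (cell₃ Γ)
  have h₂ := C.comp₃₂_id (cell₃ Δ)
  simp only [tgt₂_cell₃, src₂_cell₃] at h₁ h₂
  rw [h₁, h₂]

lemma exchange_left {x : Hom₂ Y Z} {x' : Hom₂ Y Z} (Γ : x ⟶ x') {r r' : Hom₂ X Y} (Δ : r ⟶ r') :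
    (cell₃ Γ ∘₃₁ C.id₃ r'.cell) ∘₃₂ (C.id₃ x.cell ∘₃₁ cell₃ Δ) = cell₃ Γ ∘₃₁ cell₃ Δ := by
  rw [← C.interchange₃₁₂ _ _ _ _ (by simp) (by simp) (by simp)]
  have h₁ := C.id_comp₃₂ (cell₃ Δ)
  have h₂ := C.comp₃₂_id (cell₃ Γ)
  simp only [tgt₂_cell₃, src₂_cell₃] at h₁ h₂
  rw [h₁, h₂]

/-- The basic move of the later pasting: 3-cells that act on disjoint factors commute. -/
lemma wr_wl {V' : C.Hom a b} {x : Hom₂ Y Z} {y : Hom₂ X Y} {x' : Hom₂ V' Z} {y' : Hom₂ X V'}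
    (Γ : x ⊚ y ⟶ x' ⊚ y') {r r' : Hom₂ W X} (Δ : r ⟶ r') :
    wr Γ r ≫ wl x' (wl y' Δ) = wl x (wl y Δ) ≫ wr Γ r' := hom₃_ext (by
  have h := (exchange_right Γ Δ).trans (exchange_left Γ Δ).symm
  simpa [C.id₃_comp₂₁, C.assoc₃₁] using h)

lemma comp_whisker {α β γ : Hom₂ Y Z} (Γ : α ⟶ β) (Δ : β ⟶ γ) (r : Hom₂ X Y) :
    cell₃ (Γ ≫ Δ) ∘₃₁ C.id₃ r.cell
      = (cell₃ Δ ∘₃₁ C.id₃ r.cell) ∘₃₂ (cell₃ Γ ∘₃₁ C.id₃ r.cell) := by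
  rw [cell₃_comp, ← C.interchange₃₁₂ _ _ _ _ (by simp) (by simp) (by simp)]
  have h := C.id_comp₃₂ (C.id₃ r.cell)
  simp only [tgt₂_id₃] at h
  rw [h]

/-! ### The four-step shape of the composite structural 3-cell -/

section Quad

variable {V₁ V₂ V₃ V₄ T₀ T₁ T₂ T₃ T₄ T : C.Hom a b}
  {A₁ : Hom₂ T₁ T₀} {A₂ : Hom₂ T₂ T₁} {A₃ : Hom₂ T₃ T₂} {A₄ : Hom₂ T₄ T₃}
  {B₂ : Hom₂ V₁ T₁} {B₃ : Hom₂ T₃ V₁} {C₁ : Hom₂ V₂ T₀} {C₂ : Hom₂ V₁ V₂}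
  {C₃ : Hom₂ V₃ V₁} {C₄ : Hom₂ T₄ V₃} {D₂ : Hom₂ V₄ V₂} {D₃ : Hom₂ V₃ V₄}

/-- The composite of four `3`-cells, each of which involves two adjacent factors of a composite of
four `2`-cells. -/
def quad (c₁ : A₂ ⊚ A₃ ⟶ B₂ ⊚ B₃) (c₂ : A₁ ⊚ B₂ ⟶ C₁ ⊚ C₂) (c₂' : B₃ ⊚ A₄ ⟶ C₃ ⊚ C₄)
    (c₃ : C₂ ⊚ C₃ ⟶ D₂ ⊚ D₃) : A₁ ⊚ A₂ ⊚ A₃ ⊚ A₄ ⟶ C₁ ⊚ D₂ ⊚ D₃ ⊚ C₄ :=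
  wl A₁ (wr c₁ A₄) ≫ wr c₂ (B₃ ⊚ A₄) ≫ wl C₁ (wl C₂ c₂') ≫ wl C₁ (wr c₃ C₄)

/-- The composite `quad`, precomposed with a `2`-cell. -/
def quadWr (c₁ : A₂ ⊚ A₃ ⟶ B₂ ⊚ B₃) (c₂ : A₁ ⊚ B₂ ⟶ C₁ ⊚ C₂) (c₂' : B₃ ⊚ A₄ ⟶ C₃ ⊚ C₄)
    (c₃ : C₂ ⊚ C₃ ⟶ D₂ ⊚ D₃) (r : Hom₂ T T₄) :
    A₁ ⊚ A₂ ⊚ A₃ ⊚ A₄ ⊚ r ⟶ C₁ ⊚ D₂ ⊚ D₃ ⊚ C₄ ⊚ r :=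
  wl A₁ (wr c₁ (A₄ ⊚ r)) ≫ wr c₂ (B₃ ⊚ A₄ ⊚ r) ≫ wl C₁ (wl C₂ (wr c₂' r))
    ≫ wl C₁ (wr c₃ (C₄ ⊚ r))

lemma cell₃_quad (c₁ : A₂ ⊚ A₃ ⟶ B₂ ⊚ B₃) (c₂ : A₁ ⊚ B₂ ⟶ C₁ ⊚ C₂) (c₂' : B₃ ⊚ A₄ ⟶ C₃ ⊚ C₄)
    (c₃ : C₂ ⊚ C₃ ⟶ D₂ ⊚ D₃) :
    cell₃ (quad c₁ c₂ c₂' c₃)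
      = (C.id₃ C₁.cell ∘₃₁ cell₃ c₃ ∘₃₁ C.id₃ C₄.cell) ∘₃₂ (cell₃ c₂ ∘₃₁ cell₃ c₂')
        ∘₃₂ (C.id₃ A₁.cell ∘₃₁ cell₃ c₁ ∘₃₁ C.id₃ A₄.cell) := by
  have h : quad c₁ c₂ c₂' c₃
      = (wl A₁ (wr c₁ A₄) ≫ (wr c₂ (B₃ ⊚ A₄) ≫ wl C₁ (wl C₂ c₂'))) ≫ wl C₁ (wr c₃ C₄) := by
    -- The two middle steps, `c₂` followed by `c₂'`, form the 1-composite of `c₂` and `c₂'` by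
    -- `exchange_right`; the bracketing isolates them.
    simp only [quad, Category.assoc]
  have h' := exchange_right c₂ c₂'
  have h'' : cell₃ (wr c₂ (B₃ ⊚ A₄) ≫ wl C₁ (wl C₂ c₂')) = cell₃ c₂ ∘₃₁ cell₃ c₂' := by
    rw [← h']
    simp [C.id₃_comp₂₁, C.assoc₃₁]
  rw [h, cell₃_comp, cell₃_comp, h'']
  rfl

lemma cell₃_quadWr (c₁ : A₂ ⊚ A₃ ⟶ B₂ ⊚ B₃) (c₂ : A₁ ⊚ B₂ ⟶ C₁ ⊚ C₂)
    (c₂' : B₃ ⊚ A₄ ⟶ C₃ ⊚ C₄) (c₃ : C₂ ⊚ C₃ ⟶ D₂ ⊚ D₃) (r : Hom₂ T T₄) :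
    cell₃ (quadWr c₁ c₂ c₂' c₃ r) = cell₃ (quad c₁ c₂ c₂' c₃) ∘₃₁ C.id₃ r.cell := by
  rw [quad, comp_whisker, comp_whisker, comp_whisker]
  -- The side conditions are composability of nested composites, whose own sources and targets need
  -- further side conditions; hence the larger discharge depth, here and below.
  simp (maxDischargeDepth := 8) [quadWr, C.assoc₃₁, C.id₃_comp₂₁]

end Quad

/-! ### Hexagons of 3-cells, the common form of the coherences -/

section Hexagon

variable {U V V' V'' V₁ : C.Hom a b}
    {x : Hom₂ Y Z} {y : Hom₂ X Y} {z : Hom₂ W X}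
    {x₁ : Hom₂ V Z} {y₁ : Hom₂ X V} {y₂ : Hom₂ V' V} {z₁ : Hom₂ W V'}
    {x₂ : Hom₂ V'' Z} {y₃ : Hom₂ V' V''}
    {y₁' : Hom₂ V₁ Y} {z₁' : Hom₂ W V₁} {y₂' : Hom₂ V₁ V''}

/-- A commutative hexagon of `3`-cells between composites of three `2`-cells, in which each `3`-cell
involves two adjacent `2`-cells only. -/
def Hexagon
    (c : x ⊚ y ⟶ x₁ ⊚ y₁) (d : y₁ ⊚ z ⟶ y₂ ⊚ z₁) (e : x₁ ⊚ y₂ ⟶ x₂ ⊚ y₃)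
    (c' : y ⊚ z ⟶ y₁' ⊚ z₁') (d' : x ⊚ y₁' ⟶ x₂ ⊚ y₂') (e' : y₂' ⊚ z₁' ⟶ y₃ ⊚ z₁) : Prop :=
  (wr c z ≫ wl x₁ d) ≫ wr e z₁ = (wl x c' ≫ wr d' z₁') ≫ wl x₂ e'

lemma hexagon_iff
    {c : x ⊚ y ⟶ x₁ ⊚ y₁} {d : y₁ ⊚ z ⟶ y₂ ⊚ z₁} {e : x₁ ⊚ y₂ ⟶ x₂ ⊚ y₃}
    {c' : y ⊚ z ⟶ y₁' ⊚ z₁'} {d' : x ⊚ y₁' ⟶ x₂ ⊚ y₂'} {e' : y₂' ⊚ z₁' ⟶ y₃ ⊚ z₁} :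
    Hexagon c d e c' d' e' ↔
      (cell₃ e ∘₃₁ C.id₃ z₁.cell) ∘₃₂ (C.id₃ x₁.cell ∘₃₁ cell₃ d) ∘₃₂ (cell₃ c ∘₃₁ C.id₃ z.cell)
      = (C.id₃ x₂.cell ∘₃₁ cell₃ e') ∘₃₂ (cell₃ d' ∘₃₁ C.id₃ z₁'.cell)
        ∘₃₂ (C.id₃ x.cell ∘₃₁ cell₃ c') :=
  ⟨fun h => congrArg cell₃ h, fun h => hom₃_ext h⟩

/-- For coherences made of five 3-cells, where the sixth edge is an interchange of 2-cells. -/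
lemma hexagon_ofEq_iff
    {c : x ⊚ y ⟶ x₁ ⊚ y₁} {d : y₁ ⊚ z ⟶ y₂ ⊚ z₁} {e : x₁ ⊚ y₂ ⟶ x₂ ⊚ y₃}
    {c' : y ⊚ z ⟶ y₁' ⊚ z₁'} {h : (x ⊚ y₁').cell = (x₂ ⊚ y₂').cell}
    {e' : y₂' ⊚ z₁' ⟶ y₃ ⊚ z₁} :
    Hexagon c d e c' (ofEq h) e' ↔
      (cell₃ e ∘₃₁ C.id₃ z₁.cell) ∘₃₂ (C.id₃ x₁.cell ∘₃₁ cell₃ d) ∘₃₂ (cell₃ c ∘₃₁ C.id₃ z.cell)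
      = (C.id₃ x₂.cell ∘₃₁ cell₃ e') ∘₃₂ (C.id₃ x.cell ∘₃₁ cell₃ c') := by
  rw [Hexagon, wr_ofEq, ← cell₃_wl x c', ← cell₃_comp_ofEq (wl x c') (hcomp_cell_congr h z₁'),
    ← cell₃_wl x₂, ← cell₃_comp (_ ≫ _)]
  exact ⟨fun h => congrArg cell₃ h, fun h => hom₃_ext h⟩

/-- For the coherence of two 0-composable 2-cells, which has four 3-cells and two interchanges of
2-cells. -/
lemma hexagon_ofEq_ofEq_iff
    {c : x ⊚ y ⟶ x₁ ⊚ y₁} {h : (y₁ ⊚ z).cell = (y₂ ⊚ z₁).cell} {e : x₁ ⊚ y₂ ⟶ x₂ ⊚ y₃}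
    {c' : y ⊚ z ⟶ y₁' ⊚ z₁'} {h' : (x ⊚ y₁').cell = (x₂ ⊚ y₂').cell}
    {e' : y₂' ⊚ z₁' ⟶ y₃ ⊚ z₁} :
    Hexagon c (ofEq h) e c' (ofEq h') e' ↔
      (cell₃ e ∘₃₁ C.id₃ z₁.cell) ∘₃₂ (cell₃ c ∘₃₁ C.id₃ z.cell)
      = (C.id₃ x₂.cell ∘₃₁ cell₃ e') ∘₃₂ (C.id₃ x.cell ∘₃₁ cell₃ c') := by
  rw [hexagon_ofEq_iff, ← cell₃_wl x₁ (ofEq h), wl_ofEq, ← cell₃_wr c, ← cell₃_comp,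
    cell₃_comp_ofEq]

lemma Hexagon.whisker
    {c : x ⊚ y ⟶ x₁ ⊚ y₁} {d : y₁ ⊚ z ⟶ y₂ ⊚ z₁} {e : x₁ ⊚ y₂ ⟶ x₂ ⊚ y₃}
    {c' : y ⊚ z ⟶ y₁' ⊚ z₁'} {d' : x ⊚ y₁' ⟶ x₂ ⊚ y₂'} {e' : y₂' ⊚ z₁' ⟶ y₃ ⊚ z₁}
    (H : Hexagon c d e c' d' e') (r : Hom₂ U W) :
    wr c (z ⊚ r) ≫ wl x₁ (wr d r) ≫ wr e (z₁ ⊚ r)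
      = wl x (wr c' r) ≫ wr d' (z₁' ⊚ r) ≫ wl x₂ (wr e' r) := by
  have h : cell₃ ((wr c z ≫ wl x₁ d) ≫ wr e z₁) ∘₃₁ C.id₃ r.cell
      = cell₃ ((wl x c' ≫ wr d' z₁') ≫ wl x₂ e') ∘₃₁ C.id₃ r.cell := by
    rw [show (wr c z ≫ wl x₁ d) ≫ wr e z₁ = _ from H]
  rw [← Category.assoc, ← Category.assoc]
  refine hom₃_ext ?_
  rw [comp_whisker, comp_whisker, comp_whisker, comp_whisker] at h
  simpa [-Category.assoc, C.assoc₃₁, C.id₃_comp₂₁] using h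

end Hexagon
end
end ThreeCat

/-! ### Interchange and hexagons inside longer composites -/

namespace ThreeCat

section Chase

variable {C : ThreeCat.{u}} {a b : C.Obj}

section Exchange

variable {X Y Z W V₀ V₁ V₂ : C.Hom a b} {x : Hom₂ Y Z} {y : Hom₂ X Y} {x' : Hom₂ V₀ Z}
  {y' : Hom₂ X V₀}

/-- `wr_wl` in a form usable for rewriting in the middle of a composite bracketed to the right; the
variants below add whiskering on the left. -/
lemma wr_wl_assoc (Γ : x ⊚ y ⟶ x' ⊚ y') {r r' : Hom₂ W X} (Δ : r ⟶ r') {w : Hom₂ W Z}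
    (Θ : x' ⊚ y' ⊚ r' ⟶ w) :
    wr Γ r ≫ wl x' (wl y' Δ) ≫ Θ = wl x (wl y Δ) ≫ wr Γ r' ≫ Θ := by
  rw [← Category.assoc, wr_wl, Category.assoc]

lemma wl_wr_wl (l : Hom₂ Z V₁) (Γ : x ⊚ y ⟶ x' ⊚ y') {r r' : Hom₂ W X} (Δ : r ⟶ r') :
    wl l (wr Γ r) ≫ wl l (wl x' (wl y' Δ)) = wl l (wl x (wl y Δ)) ≫ wl l (wr Γ r') := by
  rw [← wl_comp, wr_wl, wl_comp]

lemma wl_wr_wl_assoc (l : Hom₂ Z V₁) (Γ : x ⊚ y ⟶ x' ⊚ y') {r r' : Hom₂ W X} (Δ : r ⟶ r')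
    {w : Hom₂ W V₁} (Θ : l ⊚ x' ⊚ y' ⊚ r' ⟶ w) :
    wl l (wr Γ r) ≫ wl l (wl x' (wl y' Δ)) ≫ Θ
      = wl l (wl x (wl y Δ)) ≫ wl l (wr Γ r') ≫ Θ := by
  rw [← Category.assoc, wl_wr_wl, Category.assoc]

lemma wl_wl_wr_wl_assoc (k : Hom₂ V₁ V₂) (l : Hom₂ Z V₁) (Γ : x ⊚ y ⟶ x' ⊚ y') {r r' : Hom₂ W X}
    (Δ : r ⟶ r') {w : Hom₂ W V₂} (Θ : k ⊚ l ⊚ x' ⊚ y' ⊚ r' ⟶ w) :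
    wl k (wl l (wr Γ r)) ≫ wl k (wl l (wl x' (wl y' Δ))) ≫ Θ
      = wl k (wl l (wl x (wl y Δ))) ≫ wl k (wl l (wr Γ r')) ≫ Θ := by
  rw [← Category.assoc, ← wl_comp, wl_wr_wl, wl_comp, Category.assoc]

end Exchange

section HexagonAssoc

variable {X Y Z W U V V' V'' V₁ V₂ V₃ V₄ : C.Hom a b}
    {x : Hom₂ Y Z} {y : Hom₂ X Y} {z : Hom₂ W X}
    {x₁ : Hom₂ V Z} {y₁ : Hom₂ X V} {y₂ : Hom₂ V' V} {z₁ : Hom₂ W V'}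
    {x₂ : Hom₂ V'' Z} {y₃ : Hom₂ V' V''}
    {y₁' : Hom₂ V₁ Y} {z₁' : Hom₂ W V₁} {y₂' : Hom₂ V₁ V''}
    {c : x ⊚ y ⟶ x₁ ⊚ y₁} {d : y₁ ⊚ z ⟶ y₂ ⊚ z₁} {e : x₁ ⊚ y₂ ⟶ x₂ ⊚ y₃}
    {c' : y ⊚ z ⟶ y₁' ⊚ z₁'} {d' : x ⊚ y₁' ⟶ x₂ ⊚ y₂'} {e' : y₂' ⊚ z₁' ⟶ y₃ ⊚ z₁}

/-- This and the next three lemmas make a hexagon available as a rewriting rule at each position it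
occupies among the six factors. -/
lemma Hexagon.wr_assoc (H : Hexagon c d e c' d' e') (r : Hom₂ U W) {w : Hom₂ U Z}
    (Θ : x₂ ⊚ y₃ ⊚ z₁ ⊚ r ⟶ w) :
    wr c (z ⊚ r) ≫ wl x₁ (wr d r) ≫ wr e (z₁ ⊚ r) ≫ Θ
      = wl x (wr c' r) ≫ wr d' (z₁' ⊚ r) ≫ wl x₂ (wr e' r) ≫ Θ := by
  have h := congrArg (fun Γ => Γ ≫ Θ) (H.whisker r)
  simpa only [Category.assoc] using h

lemma Hexagon.wl_wr_assoc (H : Hexagon c d e c' d' e') (l : Hom₂ Z V₂) (r : Hom₂ U W)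
    {w : Hom₂ U V₂} (Θ : l ⊚ x₂ ⊚ y₃ ⊚ z₁ ⊚ r ⟶ w) :
    wl l (wr c (z ⊚ r)) ≫ wl l (wl x₁ (wr d r)) ≫ wl l (wr e (z₁ ⊚ r)) ≫ Θ
      = wl l (wl x (wr c' r)) ≫ wl l (wr d' (z₁' ⊚ r)) ≫ wl l (wl x₂ (wr e' r)) ≫ Θ := by
  have h := congrArg (fun Γ => wl l Γ ≫ Θ) (H.whisker r)
  simpa only [wl_comp, Category.assoc] using h

lemma Hexagon.wl_wl_wr_assoc (H : Hexagon c d e c' d' e') (k : Hom₂ V₂ V₃) (l : Hom₂ Z V₂)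
    (r : Hom₂ U W) {w : Hom₂ U V₃} (Θ : k ⊚ l ⊚ x₂ ⊚ y₃ ⊚ z₁ ⊚ r ⟶ w) :
    wl k (wl l (wr c (z ⊚ r))) ≫ wl k (wl l (wl x₁ (wr d r))) ≫ wl k (wl l (wr e (z₁ ⊚ r))) ≫ Θ
      = wl k (wl l (wl x (wr c' r))) ≫ wl k (wl l (wr d' (z₁' ⊚ r)))
        ≫ wl k (wl l (wl x₂ (wr e' r))) ≫ Θ := by
  have h := congrArg (fun Γ => wl k (wl l Γ) ≫ Θ) (H.whisker r)
  simpa only [wl_comp, Category.assoc] using h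

lemma Hexagon.wl_wl_wl_assoc (H : Hexagon c d e c' d' e') (j : Hom₂ V₃ V₄) (k : Hom₂ V₂ V₃)
    (l : Hom₂ Z V₂) {w : Hom₂ W V₄} (Θ : j ⊚ k ⊚ l ⊚ x₂ ⊚ y₃ ⊚ z₁ ⟶ w) :
    wl j (wl k (wl l (wr c z))) ≫ wl j (wl k (wl l (wl x₁ d))) ≫ wl j (wl k (wl l (wr e z₁))) ≫ Θ
      = wl j (wl k (wl l (wl x c'))) ≫ wl j (wl k (wl l (wr d' z₁')))
        ≫ wl j (wl k (wl l (wl x₂ e'))) ≫ Θ := by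
  have h := congrArg (fun Γ => wl j (wl k (wl l Γ)) ≫ Θ) H
  simpa only [wl_comp, Category.assoc] using h

end HexagonAssoc

/-! ### Pasting the eight hexagons -/

section Pasting

variable
    {t₀ t₁ t₂ t₃ t₄ t₅ t₆ vB vC vC' vD vD' vE vE' vH vI vJ vJ' vZ vM vN vR vT vV vX vK vK' :
      C.Hom a b}
    {A₁ : Hom₂ t₁ t₀} {A₂ : Hom₂ t₂ t₁} {A₃ : Hom₂ t₃ t₂} {A₄ : Hom₂ t₄ t₃} {A₅ : Hom₂ t₅ t₄}
    {A₆ : Hom₂ t₆ t₅} {B₂ : Hom₂ vB t₁} {B₃ : Hom₂ t₃ vB} {C₁ : Hom₂ vC t₀} {C₂ : Hom₂ vB vC}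
    {C₃ : Hom₂ vC' vB} {C₄ : Hom₂ t₄ vC'} {D₂ : Hom₂ vD vC} {D₃ : Hom₂ vC' vD}
    {D₄ : Hom₂ vD' vC'} {D₅ : Hom₂ t₅ vD'} {E₃ : Hom₂ vE vD} {E₄ : Hom₂ vD' vE}
    {E₅ : Hom₂ vE' vD'} {E₆ : Hom₂ t₆ vE'} {H₄ : Hom₂ vH vE} {H₅ : Hom₂ vE' vH}
    {I₂ : Hom₂ vI vC} {I₃ : Hom₂ vE vI} {J₁ : Hom₂ vJ t₀} {J₂ : Hom₂ vI vJ} {J₃ : Hom₂ vJ' vI}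
    {J₄ : Hom₂ vH vJ'} {Z₂ : Hom₂ vZ vJ} {Z₃ : Hom₂ vJ' vZ} {M₄ : Hom₂ vM t₃} {M₅ : Hom₂ t₅ vM}
    {N₃ : Hom₂ vN vB} {N₄ : Hom₂ vM vN} {P₄ : Hom₂ vD' vN} {Q₃ : Hom₂ vN vI} {R₂ : Hom₂ vR t₁}
    {R₃ : Hom₂ vN vR} {S₂ : Hom₂ vR vJ} {T₃ : Hom₂ vT t₂} {T₄ : Hom₂ vM vT} {U₃ : Hom₂ vT vR}
    {V₅ : Hom₂ vV vM} {V₆ : Hom₂ t₆ vV} {X₄ : Hom₂ vX vN} {X₅ : Hom₂ vE' vX} {Y₄ : Hom₂ vX vJ'}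
    {O₅ : Hom₂ vV vX} {K₃ : Hom₂ vK vR} {K₄ : Hom₂ vX vK} {L₃ : Hom₂ vK vZ}
    {K₄' : Hom₂ vK' vT} {K₅' : Hom₂ vV vK'} {L₄ : Hom₂ vK' vK}
    {c₁ : A₂ ⊚ A₃ ⟶ B₂ ⊚ B₃} {c₂ : A₁ ⊚ B₂ ⟶ C₁ ⊚ C₂} {c₂' : B₃ ⊚ A₄ ⟶ C₃ ⊚ C₄}
    {c₃ : C₂ ⊚ C₃ ⟶ D₂ ⊚ D₃} {d₁ : C₄ ⊚ A₅ ⟶ D₄ ⊚ D₅} {d₂ : D₃ ⊚ D₄ ⟶ E₃ ⊚ E₄}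
    {d₂' : D₅ ⊚ A₆ ⟶ E₅ ⊚ E₆} {d₃ : E₄ ⊚ E₅ ⟶ H₄ ⊚ H₅} {e₁ : D₂ ⊚ E₃ ⟶ I₂ ⊚ I₃}
    {e₂ : C₁ ⊚ I₂ ⟶ J₁ ⊚ J₂} {e₂' : I₃ ⊚ H₄ ⟶ J₃ ⊚ J₄} {e₃ : J₂ ⊚ J₃ ⟶ Z₂ ⊚ Z₃}
    {a₁ : A₄ ⊚ A₅ ⟶ M₄ ⊚ M₅} {a₂ : A₃ ⊚ M₄ ⟶ T₃ ⊚ T₄} {a₂' : M₅ ⊚ A₆ ⟶ V₅ ⊚ V₆}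
    {a₃ : T₄ ⊚ V₅ ⟶ K₄' ⊚ K₅'} {b₁ : L₄ ⊚ K₅' ⟶ K₄ ⊚ O₅} {b₂ : L₃ ⊚ K₄ ⟶ Z₃ ⊚ Y₄}
    {b₂' : O₅ ⊚ V₆ ⟶ X₅ ⊚ E₆} {b₃ : Y₄ ⊚ X₅ ⟶ J₄ ⊚ H₅}
    {x : B₃ ⊚ M₄ ⟶ N₃ ⊚ N₄} {g : C₃ ⊚ D₄ ⟶ N₃ ⊚ P₄} {y : N₄ ⊚ M₅ ⟶ P₄ ⊚ D₅}
    {z : C₂ ⊚ N₃ ⟶ I₂ ⊚ Q₃} {u : Q₃ ⊚ P₄ ⟶ I₃ ⊚ E₄} {p : B₂ ⊚ N₃ ⟶ R₂ ⊚ R₃}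
    {r : S₂ ⊚ R₃ ⟶ J₂ ⊚ Q₃} {q : U₃ ⊚ T₄ ⟶ R₃ ⊚ N₄} {s : P₄ ⊚ E₅ ⟶ X₄ ⊚ X₅}
    {t : Q₃ ⊚ X₄ ⟶ J₃ ⊚ Y₄} {k : R₃ ⊚ X₄ ⟶ K₃ ⊚ K₄}

/-- Eight hexagons paste to an equality of `3`-cells between composites of six `2`-cells. -/
lemma hexagons_pasting
    {σa : A₂ ⊚ T₃ ⟶ R₂ ⊚ U₃} {σb : A₁ ⊚ R₂ ⟶ J₁ ⊚ S₂} {σc : N₄ ⊚ V₅ ⟶ X₄ ⊚ O₅}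
    {σd : S₂ ⊚ K₃ ⟶ Z₂ ⊚ L₃} {σe : U₃ ⊚ K₄' ⟶ K₃ ⊚ L₄}
    (h13 : Hexagon c₂' d₁ g a₁ x y) (h121 : Hexagon c₃ d₂ e₁ g z u)
    (h1111 : Hexagon c₂ z e₂ p σb r) (h112 : Hexagon c₁ x p a₂ σa q)
    (h31 : Hexagon u d₃ e₂' s t b₃) (h1111' : Hexagon y d₂' s a₂' σc b₂')
    (h211 : Hexagon r t e₃ k σd b₂) (h22 : Hexagon q σc k a₃ σe b₁) :
    (quadWr c₁ c₂ c₂' c₃ (A₅ ⊚ A₆) ≫ wl C₁ (wl D₂ (quad d₁ d₂ d₂' d₃)))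
      ≫ quadWr e₁ e₂ e₂' e₃ (H₅ ⊚ E₆)
    = (wl A₁ (wl A₂ (quad a₁ a₂ a₂' a₃))
      ≫ (wl A₁ (wr σa (K₄' ⊚ K₅' ⊚ V₆)) ≫ wl A₁ (wl R₂ (wr σe (K₅' ⊚ V₆)))
        ≫ wr σb (K₃ ⊚ L₄ ⊚ K₅' ⊚ V₆) ≫ wl J₁ (wr σd (L₄ ⊚ K₅' ⊚ V₆))))
      ≫ wl J₁ (wl Z₂ (quad b₁ b₂ b₂' b₃)) := by
  simp only [quad, quadWr, wl_comp, Category.assoc]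
  -- The three-step side is transformed into the other one. The hexagons are used in the order
  -- `h121`, `h13`, `h1111`, `h112`, `h31`, `h1111'`, `h211`, `h22`; every other rewrite is an
  -- interchange of 3-cells on disjoint factors, which makes the edges of a hexagon consecutive or
  -- restores the order prescribed by `quad`.
  rw [wl_wr_wl_assoc C₁ c₃ (wr d₁ A₆), ← wl_wr_wl_assoc C₁ e₁ (wr d₃ E₆),
    ← wl_wr_wl_assoc C₁ e₁ (wl E₄ d₂'), h121.wl_wr_assoc, h13.wl_wl_wr_assoc,
    wr_wl_assoc c₂, wr_wl_assoc c₂, wr_wl_assoc c₂,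
    ← wr_wl_assoc e₂ (wl I₃ (wr d₃ E₆)), ← wr_wl_assoc e₂ (wl I₃ (wl E₄ d₂')),
    ← wr_wl_assoc e₂ (wr u (D₅ ⊚ A₆)), h1111.wr_assoc,
    ← wl_wr_wl_assoc A₁ p (wr y A₆), wl_wr_wl_assoc A₁ c₁ (wr a₁ A₆), h112.wl_wr_assoc,
    wl_wl_wr_wl_assoc J₁ J₂ u d₂', h31.wl_wl_wr_assoc,
    wl_wr_wl_assoc J₁ r (wl P₄ d₂'), wl_wr_wl_assoc J₁ r (wr s E₆),
    wr_wl_assoc σb (wl R₃ (wl P₄ d₂')), wr_wl_assoc σb (wl R₃ (wr s E₆)),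
    h1111'.wl_wl_wl_assoc, ← wl_wr_wl J₁ e₃ (wr b₃ E₆), h211.wl_wr_assoc,
    wr_wl_assoc σb (wr k (X₅ ⊚ E₆)), ← wl_wl_wr_wl_assoc A₁ R₂ k b₂',
    wl_wl_wr_wl_assoc A₁ R₂ q a₂', h22.wl_wl_wr_assoc,
    wl_wr_wl_assoc A₁ σa (wl T₄ a₂'), wl_wr_wl_assoc A₁ σa (wr a₃ V₆),
    ← wr_wl_assoc σb (wl K₃ (wl K₄ b₂')), ← wr_wl_assoc σb (wl K₃ (wr b₁ V₆)),
    ← wl_wr_wl_assoc J₁ σd (wl K₄ b₂'), ← wl_wr_wl_assoc J₁ σd (wr b₁ V₆),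
    ← wl_wl_wr_wl_assoc J₁ Z₂ b₂ b₂']

lemma cell₃_wl_wl {X Y Z W : C.Hom a b} (x : Hom₂ Z W) (y : Hom₂ Y Z) {α β : Hom₂ X Y} (Γ : α ⟶ β) :
    cell₃ (wl x (wl y Γ)) = C.id₃ (x.cell ∘₂₁ y.cell) ∘₃₁ cell₃ Γ := by
  rw [cell₃_wl, cell₃_wl, C.id₃_comp₂₁ _ _ (by simp), C.assoc₃₁ _ _ _ (by simp) (by simp)]

/-- The pasting of hexagons in terms of the underlying `3`-cells, when five of the `3`-cells are
identities. -/
lemma hexagons_pasting_cell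
    (ha : (A₂ ⊚ T₃).cell = (R₂ ⊚ U₃).cell) (hb : (A₁ ⊚ R₂).cell = (J₁ ⊚ S₂).cell)
    (hc : (N₄ ⊚ V₅).cell = (X₄ ⊚ O₅).cell) (hd : (S₂ ⊚ K₃).cell = (Z₂ ⊚ L₃).cell)
    (he : (U₃ ⊚ K₄').cell = (K₃ ⊚ L₄).cell)
    (h13 : Hexagon c₂' d₁ g a₁ x y) (h121 : Hexagon c₃ d₂ e₁ g z u)
    (h1111 : Hexagon c₂ z e₂ p (ofEq hb) r) (h112 : Hexagon c₁ x p a₂ (ofEq ha) q)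
    (h31 : Hexagon u d₃ e₂' s t b₃) (h1111' : Hexagon y d₂' s a₂' (ofEq hc) b₂')
    (h211 : Hexagon r t e₃ k (ofEq hd) b₂) (h22 : Hexagon q (ofEq hc) k a₃ (ofEq he) b₁) :
    (C.id₃ (J₁.cell ∘₂₁ Z₂.cell) ∘₃₁
        ((C.id₃ Z₃.cell ∘₃₁ cell₃ b₃ ∘₃₁ C.id₃ E₆.cell) ∘₃₂ (cell₃ b₂ ∘₃₁ cell₃ b₂')
          ∘₃₂ (C.id₃ L₃.cell ∘₃₁ cell₃ b₁ ∘₃₁ C.id₃ V₆.cell)))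
      ∘₃₂ (C.id₃ (A₁.cell ∘₂₁ A₂.cell) ∘₃₁
        ((C.id₃ T₃.cell ∘₃₁ cell₃ a₃ ∘₃₁ C.id₃ V₆.cell) ∘₃₂ (cell₃ a₂ ∘₃₁ cell₃ a₂')
          ∘₃₂ (C.id₃ A₃.cell ∘₃₁ cell₃ a₁ ∘₃₁ C.id₃ A₆.cell)))
    = (((C.id₃ J₁.cell ∘₃₁ cell₃ e₃ ∘₃₁ C.id₃ J₄.cell) ∘₃₂ (cell₃ e₂ ∘₃₁ cell₃ e₂')
          ∘₃₂ (C.id₃ C₁.cell ∘₃₁ cell₃ e₁ ∘₃₁ C.id₃ H₄.cell))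
        ∘₃₁ C.id₃ (H₅.cell ∘₂₁ E₆.cell))
      ∘₃₂ (C.id₃ (C₁.cell ∘₂₁ D₂.cell) ∘₃₁
        ((C.id₃ E₃.cell ∘₃₁ cell₃ d₃ ∘₃₁ C.id₃ E₆.cell) ∘₃₂ (cell₃ d₂ ∘₃₁ cell₃ d₂')
          ∘₃₂ (C.id₃ D₃.cell ∘₃₁ cell₃ d₁ ∘₃₁ C.id₃ A₆.cell)))
      ∘₃₂ (((C.id₃ C₁.cell ∘₃₁ cell₃ c₃ ∘₃₁ C.id₃ C₄.cell) ∘₃₂ (cell₃ c₂ ∘₃₁ cell₃ c₂')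
          ∘₃₂ (C.id₃ A₁.cell ∘₃₁ cell₃ c₁ ∘₃₁ C.id₃ A₄.cell))
        ∘₃₁ C.id₃ (A₅.cell ∘₂₁ A₆.cell)) := by
  have key := hexagons_pasting h13 h121 h1111 h112 h31 h1111' h211 h22
  -- Of the five identities, the one from `hc` is interior to the pasting. The other four are
  -- consecutive and fuse into a single `ofEq`, which `cell₃_comp_ofEq` then removes.
  simp only [wr_ofEq, wl_ofEq, ofEq_comp_ofEq] at key
  have key' := congrArg cell₃ key
  rw [cell₃_comp, cell₃_comp, cell₃_comp, cell₃_comp_ofEq, cell₃_quadWr, cell₃_quadWr] at key'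
  simp only [cell₃_wl_wl, cell₃_quad, hcomp_cell] at key'
  exact key'.symm

end Pasting

end Chase
end ThreeCat

/-! ### Functoriality of whiskering by 1-cells -/

namespace ThreeCat

variable {C : ThreeCat.{u}} {a b c : C.Obj}

attribute [simp] assoc₁₀ assoc₂₀ assoc₃₀ id₂_comp₁₀

-- Interchange, with the identity of `f` written as the composite of two copies of itself. The
-- analogues below use the same device.
@[simp] lemma id₂_comp₂₀_comp₂₁ (f : C.Hom b c) (β α : C.Cell₂ a b) (h : C.tgt₁ α = C.src₁ β) :
    C.id₂ f ∘₂₀ (β ∘₂₁ α) = C.id₂ f ∘₂₀ β ∘₂₁ C.id₂ f ∘₂₀ α := by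
  rw [← C.interchange₂ _ _ _ _ (by simp) h]
  congr 1
  simpa using (C.id_comp₂₁ (C.id₂ f)).symm

@[simp] lemma comp₂₁_comp₂₀_id₂ (β α : C.Cell₂ b c) (f : C.Hom a b) (h : C.tgt₁ α = C.src₁ β) :
    (β ∘₂₁ α) ∘₂₀ C.id₂ f = β ∘₂₀ C.id₂ f ∘₂₁ α ∘₂₀ C.id₂ f := by
  rw [← C.interchange₂ _ _ _ _ h (by simp)]
  congr 1
  simpa using (C.id_comp₂₁ (C.id₂ f)).symm

-- Needed separately because the simp normal form splits the identity of `g ∘₁₀ f` and brackets to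
-- the right, so that the previous lemma no longer matches a double whiskering.
@[simp] lemma comp₂₁_comp₂₀_id₂_comp₂₀_id₂ {d : C.Obj} (β α : C.Cell₂ c d) (g : C.Hom b c)
    (f : C.Hom a b) (h : C.tgt₁ α = C.src₁ β) :
    (β ∘₂₁ α) ∘₂₀ C.id₂ g ∘₂₀ C.id₂ f
      = β ∘₂₀ C.id₂ g ∘₂₀ C.id₂ f ∘₂₁ α ∘₂₀ C.id₂ g ∘₂₀ C.id₂ f := by
  simpa using comp₂₁_comp₂₀_id₂ β α (g ∘₁₀ f) h

@[simp] lemma id₃_id₂_comp₃₀_comp₃₁ (f : C.Hom b c) (Δ Γ : C.Cell₃ a b)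
    (h : C.tgt₁ (C.src₂ Γ) = C.src₁ (C.src₂ Δ)) :
    C.id₃ (C.id₂ f) ∘₃₀ (Δ ∘₃₁ Γ) = C.id₃ (C.id₂ f) ∘₃₀ Δ ∘₃₁ C.id₃ (C.id₂ f) ∘₃₀ Γ := by
  rw [← C.interchange₃₀₁ _ _ _ _ (by simp) h]
  congr 1
  simpa using (C.id_comp₃₁ (C.id₃ (C.id₂ f))).symm

@[simp] lemma comp₃₁_comp₃₀_id₃_id₂ (Δ Γ : C.Cell₃ b c) (f : C.Hom a b)
    (h : C.tgt₁ (C.src₂ Γ) = C.src₁ (C.src₂ Δ)) :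
    (Δ ∘₃₁ Γ) ∘₃₀ C.id₃ (C.id₂ f) = Δ ∘₃₀ C.id₃ (C.id₂ f) ∘₃₁ Γ ∘₃₀ C.id₃ (C.id₂ f) := by
  rw [← C.interchange₃₀₁ _ _ _ _ h (by simp)]
  congr 1
  simpa using (C.id_comp₃₁ (C.id₃ (C.id₂ f))).symm

@[simp] lemma id₃_id₂_comp₃₀_comp₃₂ (f : C.Hom b c) (Δ Γ : C.Cell₃ a b)
    (h : C.tgt₂ Γ = C.src₂ Δ) :
    C.id₃ (C.id₂ f) ∘₃₀ (Δ ∘₃₂ Γ) = C.id₃ (C.id₂ f) ∘₃₀ Δ ∘₃₂ C.id₃ (C.id₂ f) ∘₃₀ Γ := by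
  rw [← C.interchange₃₀₂ _ _ _ _ (by simp) h]
  congr 1
  simpa using (C.id_comp₃₂ (C.id₃ (C.id₂ f))).symm

@[simp] lemma comp₃₂_comp₃₀_id₃_id₂ (Δ Γ : C.Cell₃ b c) (f : C.Hom a b)
    (h : C.tgt₂ Γ = C.src₂ Δ) :
    (Δ ∘₃₂ Γ) ∘₃₀ C.id₃ (C.id₂ f) = Δ ∘₃₀ C.id₃ (C.id₂ f) ∘₃₂ Γ ∘₃₀ C.id₃ (C.id₂ f) := by
  rw [← C.interchange₃₀₂ _ _ _ _ h (by simp)]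
  congr 1
  simpa using (C.id_comp₃₂ (C.id₃ (C.id₂ f))).symm

lemma exchange₂ (β : C.Cell₂ b c) (α : C.Cell₂ a b) :
    C.id₂ (C.tgt₁ β) ∘₂₀ α ∘₂₁ β ∘₂₀ C.id₂ (C.src₁ α)
      = β ∘₂₀ C.id₂ (C.tgt₁ α) ∘₂₁ C.id₂ (C.src₁ β) ∘₂₀ α := by
  rw [← C.interchange₂ _ _ _ _ (by simp) (by simp), ← C.interchange₂ _ _ _ _ (by simp) (by simp),
    C.id_comp₂₁, C.comp₂₁_id, C.id_comp₂₁, C.comp₂₁_id]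

end ThreeCat

/-! ### The coherence for four composable 1-cells -/

namespace NormalisedOplaxFunctor

open ThreeCat

variable {A : ThreeCat.{u₁}} {B : ThreeCat.{u₂}} {C : ThreeCat.{u₃}}

section

variable (F : NormalisedOplaxFunctor A B) {a b c d : A.Obj}

@[simp] lemma src_V (g : A.Hom b c) (f : A.Hom a b) :
    B.src₁ (F.V g f) = F.map (g ∘₁₀ f) := F.isNormalisedOplax.src_V g f
@[simp] lemma tgt_V (g : A.Hom b c) (f : A.Hom a b) :
    B.tgt₁ (F.V g f) = F.map g ∘₁₀ F.map f := F.isNormalisedOplax.tgt_V g f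
@[simp] lemma src_map₂ (α : A.Cell₂ a b) : B.src₁ (F.map₂ α) = F.map (A.src₁ α) :=
  F.isNormalisedOplax.src_map₂ α
@[simp] lemma tgt_map₂ (α : A.Cell₂ a b) : B.tgt₁ (F.map₂ α) = F.map (A.tgt₁ α) :=
  F.isNormalisedOplax.tgt_map₂ α
@[simp] lemma src_W (h : A.Hom c d) (g : A.Hom b c) (f : A.Hom a b) :
    B.src₂ (F.W h g f) = B.id₂ (F.map h) ∘₂₀ F.V g f ∘₂₁ F.V h (g ∘₁₀ f) :=
  F.isNormalisedOplax.src_W h g f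
@[simp] lemma tgt_W (h : A.Hom c d) (g : A.Hom b c) (f : A.Hom a b) :
    B.tgt₂ (F.W h g f) = F.V h g ∘₂₀ B.id₂ (F.map f) ∘₂₁ F.V (h ∘₁₀ g) f :=
  F.isNormalisedOplax.tgt_W h g f
@[simp] lemma src_VR (g : A.Hom b c) (α : A.Cell₂ a b) :
    B.src₂ (F.VR g α) = B.id₂ (F.map g) ∘₂₀ F.map₂ α ∘₂₁ F.V g (A.src₁ α) :=
  F.isNormalisedOplax.src_VR g α
@[simp] lemma tgt_VR (g : A.Hom b c) (α : A.Cell₂ a b) :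
    B.tgt₂ (F.VR g α) = F.V g (A.tgt₁ α) ∘₂₁ F.map₂ (A.id₂ g ∘₂₀ α) :=
  F.isNormalisedOplax.tgt_VR g α
@[simp] lemma src_VL (β : A.Cell₂ b c) (f : A.Hom a b) :
    B.src₂ (F.VL β f) = F.V (A.tgt₁ β) f ∘₂₁ F.map₂ (β ∘₂₀ A.id₂ f) :=
  F.isNormalisedOplax.src_VL β f
@[simp] lemma tgt_VL (β : A.Cell₂ b c) (f : A.Hom a b) :
    B.tgt₂ (F.VL β f) = F.map₂ β ∘₂₀ B.id₂ (F.map f) ∘₂₁ F.V (A.src₁ β) f :=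
  F.isNormalisedOplax.tgt_VL β f
@[simp] lemma src_map₃ (Γ : A.Cell₃ a b) : B.src₂ (F.map₃ Γ) = F.map₂ (A.src₂ Γ) :=
  F.isNormalisedOplax.src_map₃ Γ
@[simp] lemma tgt_map₃ (Γ : A.Cell₃ a b) : B.tgt₂ (F.map₃ Γ) = F.map₂ (A.tgt₂ Γ) :=
  F.isNormalisedOplax.tgt_map₃ Γ
@[simp] lemma map₂_comp₂₁ (β α : A.Cell₂ a b) (h : A.tgt₁ α = A.src₁ β) :
    F.map₂ (β ∘₂₁ α) = F.map₂ β ∘₂₁ F.map₂ α := (F.isNormalisedOplax.coh_Y β α h).symm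

@[simp] lemma map₃_comp₃₂ (Δ Γ : A.Cell₃ a b) (h : A.tgt₂ Γ = A.src₂ Δ) :
    F.map₃ (Δ ∘₃₂ Γ) = F.map₃ Δ ∘₃₂ F.map₃ Γ := F.isNormalisedOplax.map₃_comp₃₂ Δ Γ h
@[simp] lemma map₃_comp₃₁_id₃ (Γ : A.Cell₃ a b) (α : A.Cell₂ a b)
    (h : A.tgt₁ α = A.src₁ (A.src₂ Γ)) :
    F.map₃ (Γ ∘₃₁ A.id₃ α) = F.map₃ Γ ∘₃₁ B.id₃ (F.map₂ α) :=
  (F.isNormalisedOplax.map₃_whisker_right Γ α h).symm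
@[simp] lemma map₃_id₃_comp₃₁ (β : A.Cell₂ a b) (Γ : A.Cell₃ a b)
    (h : A.tgt₁ (A.src₂ Γ) = A.src₁ β) :
    F.map₃ (A.id₃ β ∘₃₁ Γ) = B.id₃ (F.map₂ β) ∘₃₁ F.map₃ Γ :=
  (F.isNormalisedOplax.map₃_whisker_left β Γ h).symm

end

section

variable (G : NormalisedOplaxFunctor B C) (F : NormalisedOplaxFunctor A B)

/-- The hexagon `h1111'` of the pasting: `G` is applied to the coherence of `F`, and preserves
2-composition and whiskering by 2-cells. -/
lemma map₃_coh_1111 {a b c d e : A.Obj}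
    (i : A.Hom d e) (h : A.Hom c d) (g : A.Hom b c) (f : A.Hom a b) :
    (G.map₃ (F.W i h g ∘₃₀ B.id₃ (B.id₂ (F.map f)))
        ∘₃₁ C.id₃ (G.map₂ (F.V (i ∘₁₀ h ∘₁₀ g) f)))
      ∘₃₂ (C.id₃ (G.map₂ (B.id₂ (F.map i) ∘₂₀ F.V h g ∘₂₀ B.id₂ (F.map f)))
        ∘₃₁ G.map₃ (F.W i (h ∘₁₀ g) f))
      ∘₃₂ (G.map₃ (B.id₃ (B.id₂ (F.map i)) ∘₃₀ F.W h g f)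
        ∘₃₁ C.id₃ (G.map₂ (F.V i (h ∘₁₀ g ∘₁₀ f))))
    = (C.id₃ (G.map₂ (F.V i h ∘₂₀ B.id₂ (F.map g) ∘₂₀ B.id₂ (F.map f)))
        ∘₃₁ G.map₃ (F.W (i ∘₁₀ h) g f))
      ∘₃₂ (C.id₃ (G.map₂ (B.id₂ (F.map i) ∘₂₀ B.id₂ (F.map h) ∘₂₀ F.V g f))
        ∘₃₁ G.map₃ (F.W i h (g ∘₁₀ f))) := by
  have H := congrArg G.map₃ (F.isNormalisedOplax.coh_1111 i h g f).symm
  -- On the two-step side the two factors are 2-composable only after interchanging `F.V i h` and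
  -- `F.V g f`; this supplies the composability needed to apply `map₃_comp₃₂`.
  have hσ := congrArg (fun t => t ∘₂₁ F.V (i ∘₁₀ h) (g ∘₁₀ f)) (exchange₂ (F.V i h) (F.V g f))
  simp (maxDischargeDepth := 8) [B.assoc₂₁] at hσ
  rw [G.map₃_comp₃₂ (B.id₃ (F.V i h ∘₂₀ _) ∘₃₁ _)
    _ (by simpa (maxDischargeDepth := 8) using hσ)] at H
  simpa (maxDischargeDepth := 8) [B.assoc₂₁] using H

lemma comp_coh_1111 {a b c d e : A.Obj}
    (i : A.Hom d e) (h : A.Hom c d) (g : A.Hom b c) (f : A.Hom a b) :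
    (C.id₃ ((G.compData F).V i h ∘₂₀ C.id₂ (G.map (F.map g)) ∘₂₀ C.id₂ (G.map (F.map f)))
        ∘₃₁ (G.compData F).W (i ∘₁₀ h) g f)
      ∘₃₂ (C.id₃ (C.id₂ (G.map (F.map i)) ∘₂₀ C.id₂ (G.map (F.map h)) ∘₂₀ (G.compData F).V g f)
        ∘₃₁ (G.compData F).W i h (g ∘₁₀ f))
    = ((G.compData F).W i h g ∘₃₀ C.id₃ (C.id₂ (G.map (F.map f)))
        ∘₃₁ C.id₃ ((G.compData F).V (i ∘₁₀ h ∘₁₀ g) f))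
      ∘₃₂ (C.id₃ (C.id₂ (G.map (F.map i)) ∘₂₀ (G.compData F).V h g ∘₂₀ C.id₂ (G.map (F.map f)))
        ∘₃₁ (G.compData F).W i (h ∘₁₀ g) f)
      ∘₃₂ (C.id₃ (C.id₂ (G.map (F.map i))) ∘₃₀ (G.compData F).W h g f
        ∘₃₁ C.id₃ ((G.compData F).V i (h ∘₁₀ g ∘₁₀ f))) := by
  -- `A₁`, …, `A₆` are the factors of the common source. The families `c`, `d`, `e` come from the
  -- triples `(h,g,f)`, `(i,hg,f)`, `(i,h,g)`, and `a`, `b` from `(i,h,gf)`, `(ih,g,f)`. The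
  -- remaining cells are interior to the pasting.
  have key := hexagons_pasting_cell (C := C) (a := G.obj (F.obj a)) (b := G.obj (F.obj e))
    (t₀ := G.map (F.map i) ∘₁₀ G.map (F.map h) ∘₁₀ G.map (F.map g) ∘₁₀ G.map (F.map f))
    (t₁ := G.map (F.map i) ∘₁₀ G.map (F.map h) ∘₁₀ G.map (F.map g ∘₁₀ F.map f))
    (t₂ := G.map (F.map i) ∘₁₀ G.map (F.map h) ∘₁₀ G.map (F.map (g ∘₁₀ f)))
    (t₃ := G.map (F.map i) ∘₁₀ G.map (F.map h ∘₁₀ F.map (g ∘₁₀ f)))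
    (t₄ := G.map (F.map i) ∘₁₀ G.map (F.map (h ∘₁₀ g ∘₁₀ f)))
    (t₅ := G.map (F.map i ∘₁₀ F.map (h ∘₁₀ g ∘₁₀ f)))
    (t₆ := G.map (F.map (i ∘₁₀ h ∘₁₀ g ∘₁₀ f)))
    (vB := G.map (F.map i) ∘₁₀ G.map (F.map h ∘₁₀ F.map g ∘₁₀ F.map f))
    (vC := G.map (F.map i) ∘₁₀ G.map (F.map h ∘₁₀ F.map g) ∘₁₀ G.map (F.map f))
    (vC' := G.map (F.map i) ∘₁₀ G.map (F.map (h ∘₁₀ g) ∘₁₀ F.map f))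
    (vD := G.map (F.map i) ∘₁₀ G.map (F.map (h ∘₁₀ g)) ∘₁₀ G.map (F.map f))
    (vD' := G.map (F.map i ∘₁₀ F.map (h ∘₁₀ g) ∘₁₀ F.map f))
    (vE := G.map (F.map i ∘₁₀ F.map (h ∘₁₀ g)) ∘₁₀ G.map (F.map f))
    (vE' := G.map (F.map (i ∘₁₀ h ∘₁₀ g) ∘₁₀ F.map f))
    (vH := G.map (F.map (i ∘₁₀ h ∘₁₀ g)) ∘₁₀ G.map (F.map f))
    (vI := G.map (F.map i ∘₁₀ F.map h ∘₁₀ F.map g) ∘₁₀ G.map (F.map f))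
    (vJ := G.map (F.map i ∘₁₀ F.map h) ∘₁₀ G.map (F.map g) ∘₁₀ G.map (F.map f))
    (vJ' := G.map (F.map (i ∘₁₀ h) ∘₁₀ F.map g) ∘₁₀ G.map (F.map f))
    (vZ := G.map (F.map (i ∘₁₀ h)) ∘₁₀ G.map (F.map g) ∘₁₀ G.map (F.map f))
    (vM := G.map (F.map i ∘₁₀ F.map h ∘₁₀ F.map (g ∘₁₀ f)))
    (vN := G.map (F.map i ∘₁₀ F.map h ∘₁₀ F.map g ∘₁₀ F.map f))
    (vR := G.map (F.map i ∘₁₀ F.map h) ∘₁₀ G.map (F.map g ∘₁₀ F.map f))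
    (vT := G.map (F.map i ∘₁₀ F.map h) ∘₁₀ G.map (F.map (g ∘₁₀ f)))
    (vV := G.map (F.map (i ∘₁₀ h) ∘₁₀ F.map (g ∘₁₀ f)))
    (vX := G.map (F.map (i ∘₁₀ h) ∘₁₀ F.map g ∘₁₀ F.map f))
    (vK := G.map (F.map (i ∘₁₀ h)) ∘₁₀ G.map (F.map g ∘₁₀ F.map f))
    (vK' := G.map (F.map (i ∘₁₀ h)) ∘₁₀ G.map (F.map (g ∘₁₀ f)))
    (A₁ := { cell := C.id₂ (G.map (F.map i)) ∘₂₀ C.id₂ (G.map (F.map h)) ∘₂₀ G.V (F.map g) (F.map f) })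
    (A₂ := { cell := C.id₂ (G.map (F.map i)) ∘₂₀ C.id₂ (G.map (F.map h)) ∘₂₀ G.map₂ (F.V g f) })
    (A₃ := { cell := C.id₂ (G.map (F.map i)) ∘₂₀ G.V (F.map h) (F.map (g ∘₁₀ f)) })
    (A₄ := { cell := C.id₂ (G.map (F.map i)) ∘₂₀ G.map₂ (F.V h (g ∘₁₀ f)) })
    (A₅ := { cell := G.V (F.map i) (F.map (h ∘₁₀ g ∘₁₀ f)) })
    (A₆ := { cell := G.map₂ (F.V i (h ∘₁₀ g ∘₁₀ f)) })
    (B₂ := { cell := C.id₂ (G.map (F.map i)) ∘₂₀ G.V (F.map h) (F.map g ∘₁₀ F.map f) })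
    (B₃ := { cell := C.id₂ (G.map (F.map i)) ∘₂₀ G.map₂ (B.id₂ (F.map h) ∘₂₀ F.V g f) })
    (C₁ := { cell := C.id₂ (G.map (F.map i)) ∘₂₀ G.V (F.map h) (F.map g) ∘₂₀ C.id₂ (G.map (F.map f)) })
    (C₂ := { cell := C.id₂ (G.map (F.map i)) ∘₂₀ G.V (F.map h ∘₁₀ F.map g) (F.map f) })
    (C₃ := { cell := C.id₂ (G.map (F.map i)) ∘₂₀ G.map₂ (F.V h g ∘₂₀ B.id₂ (F.map f)) })
    (C₄ := { cell := C.id₂ (G.map (F.map i)) ∘₂₀ G.map₂ (F.V (h ∘₁₀ g) f) })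
    (D₂ := { cell := C.id₂ (G.map (F.map i)) ∘₂₀ G.map₂ (F.V h g) ∘₂₀ C.id₂ (G.map (F.map f)) })
    (D₃ := { cell := C.id₂ (G.map (F.map i)) ∘₂₀ G.V (F.map (h ∘₁₀ g)) (F.map f) })
    (D₄ := { cell := G.V (F.map i) (F.map (h ∘₁₀ g) ∘₁₀ F.map f) })
    (D₅ := { cell := G.map₂ (B.id₂ (F.map i) ∘₂₀ F.V (h ∘₁₀ g) f) })
    (E₃ := { cell := G.V (F.map i) (F.map (h ∘₁₀ g)) ∘₂₀ C.id₂ (G.map (F.map f)) })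
    (E₄ := { cell := G.V (F.map i ∘₁₀ F.map (h ∘₁₀ g)) (F.map f) })
    (E₅ := { cell := G.map₂ (F.V i (h ∘₁₀ g) ∘₂₀ B.id₂ (F.map f)) })
    (E₆ := { cell := G.map₂ (F.V (i ∘₁₀ h ∘₁₀ g) f) })
    (H₄ := { cell := G.map₂ (F.V i (h ∘₁₀ g)) ∘₂₀ C.id₂ (G.map (F.map f)) })
    (H₅ := { cell := G.V (F.map (i ∘₁₀ h ∘₁₀ g)) (F.map f) })
    (I₂ := { cell := G.V (F.map i) (F.map h ∘₁₀ F.map g) ∘₂₀ C.id₂ (G.map (F.map f)) })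
    (I₃ := { cell := G.map₂ (B.id₂ (F.map i) ∘₂₀ F.V h g) ∘₂₀ C.id₂ (G.map (F.map f)) })
    (J₁ := { cell := G.V (F.map i) (F.map h) ∘₂₀ C.id₂ (G.map (F.map g)) ∘₂₀ C.id₂ (G.map (F.map f)) })
    (J₂ := { cell := G.V (F.map i ∘₁₀ F.map h) (F.map g) ∘₂₀ C.id₂ (G.map (F.map f)) })
    (J₃ := { cell := G.map₂ (F.V i h ∘₂₀ B.id₂ (F.map g)) ∘₂₀ C.id₂ (G.map (F.map f)) })
    (J₄ := { cell := G.map₂ (F.V (i ∘₁₀ h) g) ∘₂₀ C.id₂ (G.map (F.map f)) })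
    (Z₂ := { cell := G.map₂ (F.V i h) ∘₂₀ C.id₂ (G.map (F.map g)) ∘₂₀ C.id₂ (G.map (F.map f)) })
    (Z₃ := { cell := G.V (F.map (i ∘₁₀ h)) (F.map g) ∘₂₀ C.id₂ (G.map (F.map f)) })
    (M₄ := { cell := G.V (F.map i) (F.map h ∘₁₀ F.map (g ∘₁₀ f)) })
    (M₅ := { cell := G.map₂ (B.id₂ (F.map i) ∘₂₀ F.V h (g ∘₁₀ f)) })
    (N₃ := { cell := G.V (F.map i) (F.map h ∘₁₀ F.map g ∘₁₀ F.map f) })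
    (N₄ := { cell := G.map₂ (B.id₂ (F.map i) ∘₂₀ B.id₂ (F.map h) ∘₂₀ F.V g f) })
    (P₄ := { cell := G.map₂ (B.id₂ (F.map i) ∘₂₀ F.V h g ∘₂₀ B.id₂ (F.map f)) })
    (Q₃ := { cell := G.V (F.map i ∘₁₀ F.map h ∘₁₀ F.map g) (F.map f) })
    (R₂ := { cell := G.V (F.map i) (F.map h) ∘₂₀ C.id₂ (G.map (F.map g ∘₁₀ F.map f)) })
    (R₃ := { cell := G.V (F.map i ∘₁₀ F.map h) (F.map g ∘₁₀ F.map f) })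
    (S₂ := { cell := C.id₂ (G.map (F.map i ∘₁₀ F.map h)) ∘₂₀ G.V (F.map g) (F.map f) })
    (T₃ := { cell := G.V (F.map i) (F.map h) ∘₂₀ C.id₂ (G.map (F.map (g ∘₁₀ f))) })
    (T₄ := { cell := G.V (F.map i ∘₁₀ F.map h) (F.map (g ∘₁₀ f)) })
    (U₃ := { cell := C.id₂ (G.map (F.map i ∘₁₀ F.map h)) ∘₂₀ G.map₂ (F.V g f) })
    (V₅ := { cell := G.map₂ (F.V i h ∘₂₀ B.id₂ (F.map (g ∘₁₀ f))) })
    (V₆ := { cell := G.map₂ (F.V (i ∘₁₀ h) (g ∘₁₀ f)) })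
    (X₄ := { cell := G.map₂ (F.V i h ∘₂₀ B.id₂ (F.map g) ∘₂₀ B.id₂ (F.map f)) })
    (X₅ := { cell := G.map₂ (F.V (i ∘₁₀ h) g ∘₂₀ B.id₂ (F.map f)) })
    (Y₄ := { cell := G.V (F.map (i ∘₁₀ h) ∘₁₀ F.map g) (F.map f) })
    (O₅ := { cell := G.map₂ (B.id₂ (F.map (i ∘₁₀ h)) ∘₂₀ F.V g f) })
    (K₃ := { cell := G.map₂ (F.V i h) ∘₂₀ C.id₂ (G.map (F.map g ∘₁₀ F.map f)) })
    (K₄ := { cell := G.V (F.map (i ∘₁₀ h)) (F.map g ∘₁₀ F.map f) })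
    (L₃ := { cell := C.id₂ (G.map (F.map (i ∘₁₀ h))) ∘₂₀ G.V (F.map g) (F.map f) })
    (K₄' := { cell := G.map₂ (F.V i h) ∘₂₀ C.id₂ (G.map (F.map (g ∘₁₀ f))) })
    (K₅' := { cell := G.V (F.map (i ∘₁₀ h)) (F.map (g ∘₁₀ f)) })
    (L₄ := { cell := C.id₂ (G.map (F.map (i ∘₁₀ h))) ∘₂₀ G.map₂ (F.V g f) })
    (c₁ := { cell := C.id₃ (C.id₂ (G.map (F.map i))) ∘₃₀ G.VR (F.map h) (F.V g f) })
    (c₂ := { cell := C.id₃ (C.id₂ (G.map (F.map i))) ∘₃₀ G.W (F.map h) (F.map g) (F.map f) })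
    (c₂' := { cell := C.id₃ (C.id₂ (G.map (F.map i))) ∘₃₀ G.map₃ (F.W h g f) })
    (c₃ := { cell := C.id₃ (C.id₂ (G.map (F.map i))) ∘₃₀ G.VL (F.V h g) (F.map f) })
    (d₁ := { cell := G.VR (F.map i) (F.V (h ∘₁₀ g) f) })
    (d₂ := { cell := G.W (F.map i) (F.map (h ∘₁₀ g)) (F.map f) })
    (d₂' := { cell := G.map₃ (F.W i (h ∘₁₀ g) f) })
    (d₃ := { cell := G.VL (F.V i (h ∘₁₀ g)) (F.map f) })
    (e₁ := { cell := G.VR (F.map i) (F.V h g) ∘₃₀ C.id₃ (C.id₂ (G.map (F.map f))) })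
    (e₂ := { cell := G.W (F.map i) (F.map h) (F.map g) ∘₃₀ C.id₃ (C.id₂ (G.map (F.map f))) })
    (e₂' := { cell := G.map₃ (F.W i h g) ∘₃₀ C.id₃ (C.id₂ (G.map (F.map f))) })
    (e₃ := { cell := G.VL (F.V i h) (F.map g) ∘₃₀ C.id₃ (C.id₂ (G.map (F.map f))) })
    (a₁ := { cell := G.VR (F.map i) (F.V h (g ∘₁₀ f)) })
    (a₂ := { cell := G.W (F.map i) (F.map h) (F.map (g ∘₁₀ f)) })
    (a₂' := { cell := G.map₃ (F.W i h (g ∘₁₀ f)) })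
    (a₃ := { cell := G.VL (F.V i h) (F.map (g ∘₁₀ f)) })
    (b₁ := { cell := G.VR (F.map (i ∘₁₀ h)) (F.V g f) })
    (b₂ := { cell := G.W (F.map (i ∘₁₀ h)) (F.map g) (F.map f) })
    (b₂' := { cell := G.map₃ (F.W (i ∘₁₀ h) g f) })
    (b₃ := { cell := G.VL (F.V (i ∘₁₀ h) g) (F.map f) })
    (x := { cell := G.VR (F.map i) (B.id₂ (F.map h) ∘₂₀ F.V g f) })
    (g := { cell := G.VR (F.map i) (F.V h g ∘₂₀ B.id₂ (F.map f)) })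
    (y := { cell := G.map₃ (B.id₃ (B.id₂ (F.map i)) ∘₃₀ F.W h g f) })
    (z := { cell := G.W (F.map i) (F.map h ∘₁₀ F.map g) (F.map f) })
    (u := { cell := G.VL (B.id₂ (F.map i) ∘₂₀ F.V h g) (F.map f) })
    (p := { cell := G.W (F.map i) (F.map h) (F.map g ∘₁₀ F.map f) })
    (r := { cell := G.W (F.map i ∘₁₀ F.map h) (F.map g) (F.map f) })
    (q := { cell := G.VR (F.map i ∘₁₀ F.map h) (F.V g f) })
    (s := { cell := G.map₃ (F.W i h g ∘₃₀ B.id₃ (B.id₂ (F.map f))) })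
    (t := { cell := G.VL (F.V i h ∘₂₀ B.id₂ (F.map g)) (F.map f) })
    (k := { cell := G.VL (F.V i h) (F.map g ∘₁₀ F.map f) })
    -- The five identities: a cell attached to the pair `i`, `h` passes a cell attached to the pair
    -- `g`, `f`. Each may come from the structure of `G` or from the image of that of `F`, which
    -- gives four cases; in `hc` the interchange takes place in `B` and `G` is applied to it.
    (ha := (by simpa using exchange₂ (G.V (F.map i) (F.map h)) (G.map₂ (F.V g f))))
    (hb := (by simpa using exchange₂ (G.V (F.map i) (F.map h)) (G.V (F.map g) (F.map f))))
    (hc := (by simpa using congrArg G.map₂ (exchange₂ (F.V i h) (F.V g f))))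
    (hd := (by simpa using exchange₂ (G.map₂ (F.V i h)) (G.V (F.map g) (F.map f))))
    (he := (by simpa using exchange₂ (G.map₂ (F.V i h)) (G.map₂ (F.V g f))))
    -- The source and target of `F.W h g f` are 1-composites, so `coh_VR_Y` splits both `VR` edges
    -- of the square `coh_13`, which becomes a hexagon. The same happens below for `coh_31` with
    -- `coh_VL_Y`.
    (hexagon_iff.2 (by
      simpa (maxDischargeDepth := 8) [G.isNormalisedOplax.coh_VR_Y, C.assoc₃₂, C.assoc₂₁] using
        (G.isNormalisedOplax.coh_13 (F.map i) (F.W h g f)).symm))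
    (hexagon_iff.2 (by
      simpa using (G.isNormalisedOplax.coh_121 (F.map i) (F.V h g) (F.map f)).symm))
    (hexagon_ofEq_iff.2 (by
      simpa using
        (G.isNormalisedOplax.coh_1111 (F.map i) (F.map h) (F.map g) (F.map f)).symm))
    (hexagon_ofEq_iff.2 (by
      simpa using (G.isNormalisedOplax.coh_112 (F.map i) (F.map h) (F.V g f)).symm))
    (hexagon_iff.2 (by
      simpa (maxDischargeDepth := 8) [G.isNormalisedOplax.coh_VL_Y, C.assoc₃₂, C.assoc₂₁] using
        (G.isNormalisedOplax.coh_31 (F.W i h g) (F.map f)).symm))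
    (hexagon_ofEq_iff.2 (by
      simpa using G.map₃_coh_1111 F i h g f))
    (hexagon_ofEq_iff.2 (by
      simpa using (G.isNormalisedOplax.coh_211 (F.V i h) (F.map g) (F.map f)).symm))
    (hexagon_ofEq_ofEq_iff.2 (by
      simpa using (G.isNormalisedOplax.coh_22 (F.V i h) (F.V g f)).symm))
  simpa (maxDischargeDepth := 8) [compData, ← C.id₃_comp₂₀, C.assoc₂₁] using key

end

end NormalisedOplaxFunctor

/-! ### Unit laws in a form suited to simplification -/

namespace ThreeCat

variable {C : ThreeCat.{u}} {a b c : C.Obj}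

attribute [simp] id_comp₁₀ comp₁₀_id id_comp₂₀ comp₂₀_id id_comp₃₀ comp₃₀_id

/-- The 1-cell is a variable with a side condition, so that the law applies when it is not literally
written as `C.tgt₁ α`. The next five lemmas follow the same pattern. -/
lemma id₂_comp₂₁ (α : C.Cell₂ a b) {f : C.Hom a b} (h : C.tgt₁ α = f) :
    C.id₂ f ∘₂₁ α = α := h ▸ C.id_comp₂₁ α

lemma comp₂₁_id₂ (α : C.Cell₂ a b) {f : C.Hom a b} (h : C.src₁ α = f) :
    α ∘₂₁ C.id₂ f = α := h ▸ C.comp₂₁_id α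

lemma id₃_id₂_comp₃₁ (Γ : C.Cell₃ a b) {f : C.Hom a b} (h : C.tgt₁ (C.src₂ Γ) = f) :
    C.id₃ (C.id₂ f) ∘₃₁ Γ = Γ := h ▸ C.id_comp₃₁ Γ

lemma comp₃₁_id₃_id₂ (Γ : C.Cell₃ a b) {f : C.Hom a b} (h : C.src₁ (C.src₂ Γ) = f) :
    Γ ∘₃₁ C.id₃ (C.id₂ f) = Γ := h ▸ C.comp₃₁_id Γ

lemma id₃_comp₃₂ (Γ : C.Cell₃ a b) {α : C.Cell₂ a b} (h : C.tgt₂ Γ = α) :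
    C.id₃ α ∘₃₂ Γ = Γ := h ▸ C.id_comp₃₂ Γ

lemma comp₃₂_id₃ (Γ : C.Cell₃ a b) {α : C.Cell₂ a b} (h : C.src₂ Γ = α) :
    Γ ∘₃₂ C.id₃ α = Γ := h ▸ C.comp₃₂_id Γ

/-- As `id₂_comp₁₀` is a simp lemma, the identity of a composite appears in split form; the unit
laws must also recognise it there. -/
lemma id₂_comp₂₀_id₂_comp₂₁ (α : C.Cell₂ a c) {g : C.Hom b c} {f : C.Hom a b}
    (h : C.tgt₁ α = g ∘₁₀ f) : (C.id₂ g ∘₂₀ C.id₂ f) ∘₂₁ α = α := by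
  rw [← C.id₂_comp₁₀, id₂_comp₂₁ α h]

lemma id₃_id₂_comp₂₀_id₂_comp₃₁ (Γ : C.Cell₃ a c) {g : C.Hom b c} {f : C.Hom a b}
    (h : C.tgt₁ (C.src₂ Γ) = g ∘₁₀ f) : C.id₃ (C.id₂ g ∘₂₀ C.id₂ f) ∘₃₁ Γ = Γ := by
  rw [← C.id₂_comp₁₀, id₃_id₂_comp₃₁ Γ h]

lemma id₃_id₂_comp₂₀_id₂_comp₂₀_id₂_comp₃₁ {d : C.Obj} (Γ : C.Cell₃ a d) {h : C.Hom c d}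
    {g : C.Hom b c} {f : C.Hom a b} (H : C.tgt₁ (C.src₂ Γ) = h ∘₁₀ g ∘₁₀ f) :
    C.id₃ (C.id₂ h ∘₂₀ C.id₂ g ∘₂₀ C.id₂ f) ∘₃₁ Γ = Γ := by
  rw [← C.id₂_comp₁₀, ← C.id₂_comp₁₀, id₃_id₂_comp₃₁ Γ H]

lemma id₃_comp₃₁_id₃ (β α : C.Cell₂ a b) (h : C.tgt₁ α = C.src₁ β) :
    C.id₃ β ∘₃₁ C.id₃ α = C.id₃ (β ∘₂₁ α) := (C.id₃_comp₂₁ β α h).symm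

lemma id₃_comp₃₀_id₃ (β : C.Cell₂ b c) (α : C.Cell₂ a b) :
    C.id₃ β ∘₃₀ C.id₃ α = C.id₃ (β ∘₂₀ α) := (C.id₃_comp₂₀ β α).symm

attribute [simp] id₂_comp₂₀_id₂_comp₂₁ id₃_id₂_comp₂₀_id₂_comp₃₁
  id₃_id₂_comp₂₀_id₂_comp₂₀_id₂_comp₃₁ id₃_comp₃₁_id₃ id₃_comp₃₀_id₃
  id₂_comp₂₁ comp₂₁_id₂ id₃_id₂_comp₃₁ comp₃₁_id₃_id₂ id₃_comp₃₂ comp₃₂_id₃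

end ThreeCat

/-! ### Extension by identities from a 1-category -/

namespace OplaxData₁

open ThreeCat

variable {A : ThreeCat.{u₁}} {C : ThreeCat.{u₃}}

/-- The extension by identities of data on objects and `1`-cells to `2`- and `3`-cells. -/
def extendById (P : OplaxData₁ A C) : OplaxData A C where
  toOplaxData₁ := P
  map₂ α := C.id₂ (P.map (A.src₁ α))
  VR g α := C.id₃ (P.V g (A.src₁ α))
  VL β f := C.id₃ (P.V (A.src₁ β) f)
  map₃ Γ := C.id₃ (C.id₂ (P.map (A.src₁ (A.src₂ Γ))))

/-- On a `1`-category, only the conditions on objects and `1`-cells have to be checked. -/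
lemma isNormalisedOplax_extendById (hA : A.IsOneCategory) (P : OplaxData₁ A C)
    (h_src_V : ∀ {a b c : A.Obj} (g : A.Hom b c) (f : A.Hom a b),
      C.src₁ (P.V g f) = P.map (g ∘₁₀ f))
    (h_tgt_V : ∀ {a b c : A.Obj} (g : A.Hom b c) (f : A.Hom a b),
      C.tgt₁ (P.V g f) = P.map g ∘₁₀ P.map f)
    (h_src_W : ∀ {a b c d : A.Obj} (h : A.Hom c d) (g : A.Hom b c) (f : A.Hom a b),
      C.src₂ (P.W h g f) = C.id₂ (P.map h) ∘₂₀ P.V g f ∘₂₁ P.V h (g ∘₁₀ f))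
    (h_tgt_W : ∀ {a b c d : A.Obj} (h : A.Hom c d) (g : A.Hom b c) (f : A.Hom a b),
      C.tgt₂ (P.W h g f) = P.V h g ∘₂₀ C.id₂ (P.map f) ∘₂₁ P.V (h ∘₁₀ g) f)
    (h_map_id : ∀ a : A.Obj, P.map (A.id₁ a) = C.id₁ (P.obj a))
    (h_V_id_left : ∀ {a b : A.Obj} (f : A.Hom a b), P.V (A.id₁ b) f = C.id₂ (P.map f))
    (h_V_id_right : ∀ {a b : A.Obj} (f : A.Hom a b), P.V f (A.id₁ a) = C.id₂ (P.map f))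
    (h_W_id_right : ∀ {a b c : A.Obj} (g : A.Hom b c) (f : A.Hom a b),
      P.W g f (A.id₁ a) = C.id₃ (P.V g f))
    (h_W_id_middle : ∀ {a b c : A.Obj} (g : A.Hom b c) (f : A.Hom a b),
      P.W g (A.id₁ b) f = C.id₃ (P.V g f))
    (h_W_id_left : ∀ {a b c : A.Obj} (g : A.Hom b c) (f : A.Hom a b),
      P.W (A.id₁ c) g f = C.id₃ (P.V g f))
    (h_coh_1111 : ∀ {a b c d e : A.Obj}
      (i : A.Hom d e) (h : A.Hom c d) (g : A.Hom b c) (f : A.Hom a b),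
      (C.id₃ (P.V i h ∘₂₀ C.id₂ (P.map g) ∘₂₀ C.id₂ (P.map f)) ∘₃₁ P.W (i ∘₁₀ h) g f)
        ∘₃₂ (C.id₃ (C.id₂ (P.map i) ∘₂₀ C.id₂ (P.map h) ∘₂₀ P.V g f) ∘₃₁ P.W i h (g ∘₁₀ f))
      = (P.W i h g ∘₃₀ C.id₃ (C.id₂ (P.map f)) ∘₃₁ C.id₃ (P.V (i ∘₁₀ h ∘₁₀ g) f))
        ∘₃₂ (C.id₃ (C.id₂ (P.map i) ∘₂₀ P.V h g ∘₂₀ C.id₂ (P.map f)) ∘₃₁ P.W i (h ∘₁₀ g) f)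
        ∘₃₂ (C.id₃ (C.id₂ (P.map i)) ∘₃₀ P.W h g f ∘₃₁ C.id₃ (P.V i (h ∘₁₀ g ∘₁₀ f)))) :
    P.extendById.IsNormalisedOplax where
  src_V g f := h_src_V g f
  tgt_V g f := h_tgt_V g f
  src_map₂ α := by simp [extendById]
  tgt_map₂ α := by
    obtain ⟨f, rfl⟩ := hA.cell₂_eq α
    simp [extendById]
  src_W h g f := h_src_W h g f
  tgt_W h g f := h_tgt_W h g f
  src_VR g α := by
    obtain ⟨f, rfl⟩ := hA.cell₂_eq α
    simp [extendById, h_tgt_V]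
  tgt_VR g α := by
    obtain ⟨f, rfl⟩ := hA.cell₂_eq α
    simp [extendById, h_src_V]
  src_VL β f := by
    obtain ⟨g, rfl⟩ := hA.cell₂_eq β
    simp [extendById, h_src_V]
  tgt_VL β f := by
    obtain ⟨g, rfl⟩ := hA.cell₂_eq β
    simp [extendById, h_tgt_V]
  src_map₃ Γ := by simp [extendById]
  tgt_map₃ Γ := by
    simp [extendById, A.src₁_src₂]
  map_id a := h_map_id a
  map₂_id f := by simp [extendById]
  V_id_left f := h_V_id_left f
  V_id_right f := h_V_id_right f
  map₃_id α := by simp [extendById]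
  W_id_right g f := h_W_id_right g f
  W_id_middle g f := h_W_id_middle g f
  W_id_left g f := h_W_id_left g f
  VR_id₂ g f := by simp [extendById]
  VR_id₁ α := by simp [extendById, h_V_id_left]
  VL_id₂ g f := by simp [extendById]
  VL_id₁ β := by simp [extendById, h_V_id_right]
  coh_Y β α h := by
    obtain ⟨f, rfl⟩ := hA.cell₂_eq α
    obtain ⟨g, rfl⟩ := hA.cell₂_eq β
    simp only [tgt₁_id₂, src₁_id₂] at h
    subst h
    simp [extendById]
  coh_1111 i h g f := h_coh_1111 i h g f
  -- Once `α` is an identity, every 3-cell except `P.W` is one too, and both sides reduce to the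
  -- same value of `P.W`; likewise for the next two coherences.
  coh_211 α g f := by
    obtain ⟨h, rfl⟩ := hA.cell₂_eq α
    simp [extendById, h_src_V, h_tgt_V, h_src_W, h_tgt_W]
  coh_121 h α f := by
    obtain ⟨g, rfl⟩ := hA.cell₂_eq α
    simp [extendById, h_src_V, h_tgt_V, h_src_W, h_tgt_W]
  coh_112 h g α := by
    obtain ⟨f, rfl⟩ := hA.cell₂_eq α
    simp [extendById, h_src_V, h_tgt_V, h_src_W, h_tgt_W]
  coh_VR_Y g β α h := by
    obtain ⟨f, rfl⟩ := hA.cell₂_eq α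
    obtain ⟨f', rfl⟩ := hA.cell₂_eq β
    simp only [tgt₁_id₂, src₁_id₂] at h
    subst h
    simp [extendById, h_src_V, h_tgt_V]
  coh_VL_Y β α f h := by
    obtain ⟨g, rfl⟩ := hA.cell₂_eq α
    obtain ⟨g', rfl⟩ := hA.cell₂_eq β
    simp only [tgt₁_id₂, src₁_id₂] at h
    subst h
    simp [extendById, h_src_V, h_tgt_V]
  coh_22 β α := by
    obtain ⟨f, rfl⟩ := hA.cell₂_eq α
    obtain ⟨g, rfl⟩ := hA.cell₂_eq β
    simp [extendById, h_src_V, h_tgt_V]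
  coh_YY γ β α h h' := by
    obtain ⟨f, rfl⟩ := hA.cell₂_eq α
    obtain ⟨g, rfl⟩ := hA.cell₂_eq β
    obtain ⟨k, rfl⟩ := hA.cell₂_eq γ
    simp only [tgt₁_id₂, src₁_id₂] at h h'
    subst h h'
    simp [extendById]
  map₃_comp₃₂ Δ Γ h := by
    have h' : A.src₁ (A.src₂ Γ) = A.src₁ (A.src₂ Δ) := by rw [A.src₁_src₂, h]
    simp [extendById, h, h']
  map₃_whisker_right Γ α h := by
    obtain ⟨f, rfl⟩ := hA.cell₂_eq α
    simp only [tgt₁_id₂] at h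
    simp [extendById, h]
  map₃_whisker_left β Γ h := by
    obtain ⟨α, rfl⟩ := hA.cell₃_eq Γ
    obtain ⟨f, rfl⟩ := hA.cell₂_eq α
    obtain ⟨g, rfl⟩ := hA.cell₂_eq β
    simp only [tgt₁_id₂, src₁_id₂, src₂_id₃] at h
    subst h
    simp [extendById]
  coh_31 Γ f := by
    obtain ⟨α, rfl⟩ := hA.cell₃_eq Γ
    obtain ⟨g, rfl⟩ := hA.cell₂_eq α
    simp [extendById, h_src_V, h_tgt_V]
  coh_13 g Γ := by
    obtain ⟨α, rfl⟩ := hA.cell₃_eq Γ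
    obtain ⟨f, rfl⟩ := hA.cell₂_eq α
    simp [extendById, h_src_V, h_tgt_V]


end OplaxData₁

/-! ### Normalisation of the composite, and uniqueness -/

namespace NormalisedOplaxFunctor

open ThreeCat

variable {A : ThreeCat.{u₁}} {B : ThreeCat.{u₂}} {C : ThreeCat.{u₃}}

section

variable (F : NormalisedOplaxFunctor A B) {a b c d : A.Obj}

@[simp] lemma map_id (a : A.Obj) : F.map (A.id₁ a) = B.id₁ (F.obj a) :=
  F.isNormalisedOplax.map_id a
@[simp] lemma map₂_id (f : A.Hom a b) : F.map₂ (A.id₂ f) = B.id₂ (F.map f) :=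
  F.isNormalisedOplax.map₂_id f
@[simp] lemma map₃_id (α : A.Cell₂ a b) : F.map₃ (A.id₃ α) = B.id₃ (F.map₂ α) :=
  F.isNormalisedOplax.map₃_id α
@[simp] lemma V_id_left (f : A.Hom a b) : F.V (A.id₁ b) f = B.id₂ (F.map f) :=
  F.isNormalisedOplax.V_id_left f
@[simp] lemma V_id_right (f : A.Hom a b) : F.V f (A.id₁ a) = B.id₂ (F.map f) :=
  F.isNormalisedOplax.V_id_right f
@[simp] lemma W_id_right (g : A.Hom b c) (f : A.Hom a b) :
    F.W g f (A.id₁ a) = B.id₃ (F.V g f) := F.isNormalisedOplax.W_id_right g f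
@[simp] lemma W_id_middle (g : A.Hom b c) (f : A.Hom a b) :
    F.W g (A.id₁ b) f = B.id₃ (F.V g f) := F.isNormalisedOplax.W_id_middle g f
@[simp] lemma W_id_left (g : A.Hom b c) (f : A.Hom a b) :
    F.W (A.id₁ c) g f = B.id₃ (F.V g f) := F.isNormalisedOplax.W_id_left g f
@[simp] lemma VR_id₂ (g : A.Hom b c) (f : A.Hom a b) :
    F.VR g (A.id₂ f) = B.id₃ (F.V g f) := F.isNormalisedOplax.VR_id₂ g f
@[simp] lemma VR_id₁ (α : A.Cell₂ a b) : F.VR (A.id₁ b) α = B.id₃ (F.map₂ α) :=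
  F.isNormalisedOplax.VR_id₁ α
@[simp] lemma VL_id₂ (g : A.Hom b c) (f : A.Hom a b) :
    F.VL (A.id₂ g) f = B.id₃ (F.V g f) := F.isNormalisedOplax.VL_id₂ g f
@[simp] lemma VL_id₁ (β : A.Cell₂ a b) : F.VL β (A.id₁ a) = B.id₃ (F.map₂ β) :=
  F.isNormalisedOplax.VL_id₁ β

end

section

variable (G : NormalisedOplaxFunctor B C) (F : NormalisedOplaxFunctor A B) {a b c d : A.Obj}

@[simp] lemma comp_src_V (g : A.Hom b c) (f : A.Hom a b) :
    C.src₁ ((G.compData F).V g f) = G.map (F.map (g ∘₁₀ f)) := by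
  simp [compData]

@[simp] lemma comp_tgt_V (g : A.Hom b c) (f : A.Hom a b) :
    C.tgt₁ ((G.compData F).V g f) = G.map (F.map g) ∘₁₀ G.map (F.map f) := by
  simp [compData]

@[simp] lemma comp_src_W (h : A.Hom c d) (g : A.Hom b c) (f : A.Hom a b) :
    C.src₂ ((G.compData F).W h g f)
      = C.id₂ (G.map (F.map h)) ∘₂₀ (G.compData F).V g f ∘₂₁ (G.compData F).V h (g ∘₁₀ f) := by
  simp (maxDischargeDepth := 8) [compData, C.assoc₂₁]

@[simp] lemma comp_tgt_W (h : A.Hom c d) (g : A.Hom b c) (f : A.Hom a b) :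
    C.tgt₂ ((G.compData F).W h g f)
      = (G.compData F).V h g ∘₂₀ C.id₂ (G.map (F.map f)) ∘₂₁ (G.compData F).V (h ∘₁₀ g) f := by
  simp (maxDischargeDepth := 8) [compData, C.assoc₂₁]

lemma comp_map_id (a : A.Obj) :
    (G.compData F).map (A.id₁ a) = C.id₁ ((G.compData F).obj a) := by
  simp [compData]

lemma comp_V_id_left (f : A.Hom a b) :
    (G.compData F).V (A.id₁ b) f = C.id₂ (G.map (F.map f)) := by
  simp [compData]

lemma comp_V_id_right (f : A.Hom a b) :
    (G.compData F).V f (A.id₁ a) = C.id₂ (G.map (F.map f)) := by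
  simp [compData]

/-- An identity in any of the three slots turns each of `G.VR`, `G.W`, `G.map₃` of `F.W` and `G.VL`
into an identity 3-cell, by normalisation of `F` and `G`; hence this lemma and the next two. -/
lemma comp_W_id_right (g : A.Hom b c) (f : A.Hom a b) :
    (G.compData F).W g f (A.id₁ a) = C.id₃ ((G.compData F).V g f) := by
  simp (maxDischargeDepth := 8) [compData]

lemma comp_W_id_middle (g : A.Hom b c) (f : A.Hom a b) :
    (G.compData F).W g (A.id₁ b) f = C.id₃ ((G.compData F).V g f) := by
  simp (maxDischargeDepth := 8) [compData]

lemma comp_W_id_left (g : A.Hom b c) (f : A.Hom a b) :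
    (G.compData F).W (A.id₁ c) g f = C.id₃ ((G.compData F).V g f) := by
  simp (maxDischargeDepth := 8) [compData]

/-- A normalised oplax `3`-functor on a `1`-category is determined by its values on objects and
`1`-cells. -/
lemma eq_of_toOplaxData₁_eq (hA : A.IsOneCategory) (H K : NormalisedOplaxFunctor A C)
    (h : H.toOplaxData₁ = K.toOplaxData₁) : H = K := by
  obtain ⟨⟨P, m, r, l, n⟩, hP⟩ := H
  obtain ⟨⟨Q, m', r', l', n'⟩, hQ⟩ := K
  obtain rfl : P = Q := h
  have h₁ : @m = @m' := by
    funext a b α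
    obtain ⟨f, rfl⟩ := hA.cell₂_eq α
    exact (hP.map₂_id f).trans (hQ.map₂_id f).symm
  have h₂ : @r = @r' := by
    funext a b c g α
    obtain ⟨f, rfl⟩ := hA.cell₂_eq α
    exact (hP.VR_id₂ g f).trans (hQ.VR_id₂ g f).symm
  have h₃ : @l = @l' := by
    funext a b c β f
    obtain ⟨g, rfl⟩ := hA.cell₂_eq β
    exact (hP.VL_id₂ g f).trans (hQ.VL_id₂ g f).symm
  -- The values on 2-cells must be identified first: `map₃_id` expresses the value on an identity
  -- 3-cell through them.
  subst h₁
  have h₄ : @n = @n' := by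
    funext a b Γ
    obtain ⟨α, rfl⟩ := hA.cell₃_eq Γ
    exact (hP.map₃_id α).trans (hQ.map₃_id α).symm
  subst h₂ h₃ h₄
  rfl

end

end NormalisedOplaxFunctor


theorem mainTheorem6 (A : ThreeCat.{u₁}) (B : ThreeCat.{u₂}) (C : ThreeCat.{u₃})
    (hA : A.IsOneCategory)
    (F : NormalisedOplaxFunctor A B) (G : NormalisedOplaxFunctor B C) :
    ∃! GF : NormalisedOplaxFunctor A C, GF.toOplaxData₁ = G.compData F := by
  refine ⟨⟨(G.compData F).extendById, OplaxData₁.isNormalisedOplax_extendById hA _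
    (G.comp_src_V F) (G.comp_tgt_V F) (G.comp_src_W F) (G.comp_tgt_W F) (G.comp_map_id F)
    (G.comp_V_id_left F) (G.comp_V_id_right F) (G.comp_W_id_right F) (G.comp_W_id_middle F)
    (G.comp_W_id_left F) (G.comp_coh_1111 F)⟩, rfl, ?_⟩
  intro H hH
  exact H.eq_of_toOplaxData₁_eq hA _ hH
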